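/- A chain is a linearly ordered set; it is scattered if it embeds no dense linear order with more than one point (equivalently, it does not embed $\mathbb{Q}$). The Hausdorff degree $\mathrm{Hdeg}(C)$ of a scattered chain $C$ is the ordinal defined by recursion as follows: $\mathrm{Hdeg}(C)=0$ iff $C$ is finite; for $\alpha>0$, $\mathrm{Hdeg}(C)=\alpha$ iff $\mathrm{Hdeg}(C)\neq\beta$ for all $\beta<\alpha$ and $C=\sum_{i\in I}C_i$ (concatenation of segments along $I$), where $I$ is well ordered or inversely well ordered and each $C_i$ has Hausdorff degree less than $\alpha$. The monadic language of order has element variables and set variables, the latter ranging over all subsets of the chain, the atomic formulas $x=y$, $x\le y$, $x\in X$, $X\subseteq Y$ and "$X$ is a singleton", the Boolean connectives, and quantifiers over elements and over subsets. The quantifier depth of a formula is the maximal number of nested quantifiers (of either kind). Let $\varphi(x,X,\bar Z)$ be such a formula, and let $\bar P$ be a finite sequence of subsets of $C$ (the parameters), of the same length as $\bar Z$. One says that $\varphi(x,X,\bar P)$ defines a choice function on $C$ if 1. $C\models\varphi(a,A,\bar P)$ implies $A\neq\emptyset$ and $a\in A$; 2. for every nonempty $A\subseteq C$ there is $y\in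 C$ with $C\models\varphi(y,A,\bar P)$; 3. $C\models\varphi(a,A,\bar P)$ and $C\models\varphi(b,A,\bar P)$ imply $a=b$. **Theorem.** For all $m,l<\omega$ there is an $n<\omega$ such that, for every scattered chain $C$ with $\mathrm{Hdeg}(C)\ge n+1$, there are no monadic formula $\varphi(x,X,\bar Z)$ of quantifier depth at most $m$ and no sequence $\bar P$ of at most $l$ subsets of $C$ such that $\varphi(x,X,\bar P)$ defines a choice function on $C$. -/

import Mathlib

universe u

/-- Formulas of the monadic second-order language of order, with `e` free element variables and
`s` free set variables. Elements and arbitrary subsets may be quantified. The bound variable of a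
quantifier is the variable with index `0` of the formula under it, and the other variables are
shifted by one. The connectives and quantifiers that are not listed are abbreviations, with the
same quantifier depth. -/
inductive MonadicFormula : ℕ → ℕ → Type
  /-- the false formula -/
  | bot {e s : ℕ} : MonadicFormula e s
  /-- `x = y` -/
  | eq {e s : ℕ} (x y : Fin e) : MonadicFormula e s
  /-- `x ≤ y` -/
  | le {e s : ℕ} (x y : Fin e) : MonadicFormula e s
  /-- `x ∈ X` -/
  | mem {e s : ℕ} (x : Fin e) (X : Fin s) : MonadicFormula e s
  /-- `X ⊆ Y` -/
  | subset {e s : ℕ} (X Y : Fin s) : MonadicFormula e s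
  /-- `X` is a singleton -/
  | sing {e s : ℕ} (X : Fin s) : MonadicFormula e s
  /-- negation -/
  | not {e s : ℕ} (φ : MonadicFormula e s) : MonadicFormula e s
  /-- conjunction -/
  | and {e s : ℕ} (φ ψ : MonadicFormula e s) : MonadicFormula e s
  /-- existential quantifier over elements -/
  | exElem {e s : ℕ} (φ : MonadicFormula (e + 1) s) : MonadicFormula e s
  /-- existential quantifier over subsets -/
  | exSet {e s : ℕ} (φ : MonadicFormula e (s + 1)) : MonadicFormula e s

namespace MonadicFormula

/-- Quantifier depth: the largest number of nested quantifiers, of either kind. -/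
def depth : {e s : ℕ} → MonadicFormula e s → ℕ
  | _, _, bot => 0
  | _, _, eq _ _ => 0
  | _, _, le _ _ => 0
  | _, _, mem _ _ => 0
  | _, _, subset _ _ => 0
  | _, _, sing _ => 0
  | _, _, not φ => φ.depth
  | _, _, and φ ψ => max φ.depth ψ.depth
  | _, _, exElem φ => φ.depth + 1
  | _, _, exSet φ => φ.depth + 1

/-- Satisfaction in the chain `C`, where `v` and `V` assign elements and subsets of `C` to the free
variables. -/
def Sat {C : Type u} [LinearOrder C] :
    {e s : ℕ} → MonadicFormula e s → (Fin e → C) → (Fin s → Set C) → Prop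
  | _, _, bot, _, _ => False
  | _, _, eq x y, v, _ => v x = v y
  | _, _, le x y, v, _ => v x ≤ v y
  | _, _, mem x X, v, V => v x ∈ V X
  | _, _, subset X Y, _, V => V X ⊆ V Y
  | _, _, sing X, _, V => ∃ a : C, V X = {a}
  | _, _, not φ, v, V => ¬ φ.Sat v V
  | _, _, and φ ψ, v, V => φ.Sat v V ∧ ψ.Sat v V
  | e, _, exElem φ, v, V => ∃ a : C, φ.Sat (Fin.cons a v : Fin (e + 1) → C) V
  | _, s, exSet φ, v, V => ∃ A : Set C, φ.Sat v (Fin.cons A V : Fin (s + 1) → Set C)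

/-- `C ⊨ φ(a, A, P)`, for a formula `φ(x, X, Z)` in one element variable `x`, a set variable `X`
(the one with index `0`), and `k` further set variables `Z`, which stand for the parameters `P`. -/
def Holds {C : Type u} [LinearOrder C] {k : ℕ} (φ : MonadicFormula 1 (k + 1))
    (a : C) (A : Set C) (P : Fin k → Set C) : Prop :=
  φ.Sat (fun _ => a) (Fin.cons A P : Fin (k + 1) → Set C)

/-- The formula `φ(x, X, P)` defines a choice function on the nonempty subsets of `C`. -/
def DefinesChoice {C : Type u} [LinearOrder C] {k : ℕ} (φ : MonadicFormula 1 (k + 1))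
    (P : Fin k → Set C) : Prop :=
  (∀ (a : C) (A : Set C), φ.Holds a A P → A.Nonempty ∧ a ∈ A) ∧
  (∀ A : Set C, A.Nonempty → ∃ y : C, φ.Holds y A P) ∧
  (∀ (a b : C) (A : Set C), φ.Holds a A P → φ.Holds b A P → a = b)

end MonadicFormula

/-- A chain is scattered if it embeds no dense order (equivalently, does not embed `ℚ`). -/
def IsScatteredChain (C : Type u) [LinearOrder C] : Prop :=
  IsEmpty (ℚ ↪o C)

/-- `HasHdeg α C`: the Hausdorff degree of the chain `C` is `α`. Degree `0` means finite; for
`α ≠ 0`, no smaller ordinal is the degree of `C`, and `C` is a sum `∑ i ∈ I, C i` of chains of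
degree less than `α`, with `I` well ordered or inversely well ordered. A decomposition of `C` into
such a sum is given by the monotone map `f : C → I` that sends the segment `C i` to `i`. -/
def HasHdeg (α : Ordinal.{u}) (C : Type u) [LinearOrder C] : Prop :=
  (α = 0 ∧ Finite C) ∨
  (α ≠ 0 ∧ (∀ β : Ordinal.{u}, ∀ _ : β < α, ¬ HasHdeg β C) ∧
    ∃ (I : Type u) (_ : LinearOrder I) (f : C → I),
      (WellFoundedLT I ∨ WellFoundedGT I) ∧ Monotone f ∧
      ∀ i : I, ∃ β : Ordinal.{u}, ∃ _ : β < α, HasHdeg β {x : C // f x = i})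
termination_by α

/-- `Hdeg(C) ≥ α`: no ordinal below `α` is the Hausdorff degree of `C`. -/
def HdegGE (C : Type u) [LinearOrder C] (α : Ordinal.{u}) : Prop :=
  ∀ β : Ordinal.{u}, β < α → ¬ HasHdeg β C

/-! A formula of depth at most m sees a segment only through its type, an element of a finite monoid
M in which concatenation is multiplication. So it suffices to find a nonempty set A in which every a
has a partner b ≠ a with the same parameters and the same types of the chain to its left and to its
right (`SegmentType.Blurred`): a formula that holds of a then holds of b (`holds_iff_of_tp_eq`).

Large degree supplies nested sums, alternately along increasing and decreasing sequences. Ramsey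
thinning of an increasing sequence gives segments of one type t separated by gaps of one type q, and
the type s of the sum satisfies s = t q s. Suppose that the part of a segment to the left of any
element of its chosen subset has type in t M. If t lies in s M, then t q t = t, so preceding blocks
are absorbed and corresponding elements of different segments are indistinguishable. If not,
finiteness of M makes the two-sided ideal of s strictly smaller than that of t. In the sum, the
parts to the right of chosen elements have types in M s, which is the supposition for the next level
once the order is reversed; hence the alternation. The ideals cannot shrink forever, so height |M| +
1 forces a blurred set (`blurred_of_upTree`).

That absence of trees bounds the degree (`hausdorffLE_of_not_upTree`) is a condensation argument:
identify points when the interval between them is an inversely well ordered sum of segments of lower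
rank. Without increasing sequences of dual trees, neighbouring classes merge, and scatteredness
leaves only one class. -/

open scoped Pointwise

/-! ### Monadic types and their composition -/

/-- The types of quantifier depth `m` of words over the alphabet `σ`: the atomic type of a word
lists its letters and the pairs of letters at increasing positions, and the type of depth `m + 1`
lists the types of depth `m` of the expansions by a subset. -/
def MSOType : ℕ → Type → Type
  | 0, σ => Set σ × Set (σ × σ)
  | m + 1, σ => Set (MSOType m (σ × Prop))

/-- The product of atomic types that corresponds to concatenation of words. -/
@[reducible] def atomicMonoid (σ : Type) : Monoid (Set σ × Set (σ × σ)) where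
  one := (∅, ∅)
  mul p q := (p.1 ∪ q.1, p.2 ∪ q.2 ∪ p.1 ×ˢ q.1)
  mul_assoc p q r := by
    refine Prod.ext (Set.union_assoc _ _ _) ?_
    change (p.2 ∪ q.2 ∪ p.1 ×ˢ q.1) ∪ r.2 ∪ (p.1 ∪ q.1) ×ˢ r.1 =
      p.2 ∪ (q.2 ∪ r.2 ∪ q.1 ×ˢ r.1) ∪ p.1 ×ˢ (q.1 ∪ r.1)
    ext ⟨a, b⟩
    simp only [Set.mem_union, Set.mem_prod]
    tauto
  one_mul p := by
    refine Prod.ext (Set.empty_union _) ?_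
    change ∅ ∪ p.2 ∪ ∅ ×ˢ p.1 = p.2
    simp
  mul_one p := by
    refine Prod.ext (Set.union_empty _) ?_
    change p.2 ∪ ∅ ∪ p.1 ×ˢ ∅ = p.2
    simp

instance MSOType.instMonoid : (m : ℕ) → (σ : Type) → Monoid (MSOType m σ)
  | 0, σ => atomicMonoid σ
  | m + 1, σ => @Set.monoid _ (MSOType.instMonoid m (σ × Prop))

instance MSOType.instFinite : (m : ℕ) → (σ : Type) → [Finite σ] → Finite (MSOType m σ)
  | 0, σ, _ => inferInstanceAs (Finite (Set σ × Set (σ × σ)))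
  | m + 1, σ, _ =>
    haveI := MSOType.instFinite m (σ × Prop)
    inferInstanceAs (Finite (Set (MSOType m (σ × Prop))))

section Types

variable {C : Type u} [LinearOrder C]

/-- The type of depth `m` of the restriction to `D` of the word `c : C → σ`. -/
def msoType : (m : ℕ) → {σ : Type} → (C → σ) → Set C → MSOType m σ
  | 0, _, c, D => (c '' D, {p | ∃ x ∈ D, ∃ y ∈ D, x < y ∧ (c x, c y) = p})
  | m + 1, _, c, D => {t | ∃ A : Set C, msoType m (fun x => (c x, x ∈ A)) D = t}

theorem exists_expansion_of_msoType_eq {m : ℕ} {σ : Type} {c c' : C → σ} {D D' : Set C}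
    (h : msoType (m + 1) c D = msoType (m + 1) c' D') (A : Set C) :
    ∃ B : Set C, msoType m (fun x => (c' x, x ∈ B)) D' = msoType m (fun x => (c x, x ∈ A)) D := by
  have hsub : {t | ∃ A : Set C, msoType m (fun x => (c x, x ∈ A)) D = t} =
    {t | ∃ A : Set C, msoType m (fun x => (c' x, x ∈ A)) D' = t} := h
  exact hsub.subset ⟨A, rfl⟩

theorem msoType_congr (m : ℕ) {σ : Type} {c c' : C → σ} {D : Set C} (h : ∀ x ∈ D, c x = c' x) :
    msoType m c D = msoType m c' D := by
  induction m generalizing σ with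
  | zero =>
    refine Prod.ext (Set.image_congr h) ?_
    ext p
    constructor
    · rintro ⟨x, hx, y, hy, hxy, rfl⟩
      exact ⟨x, hx, y, hy, hxy, by rw [h x hx, h y hy]⟩
    · rintro ⟨x, hx, y, hy, hxy, rfl⟩
      exact ⟨x, hx, y, hy, hxy, by rw [h x hx, h y hy]⟩
  | succ m ih =>
    have key (A : Set C) : msoType m (fun x => (c x, x ∈ A)) D =
        msoType m (fun x => (c' x, x ∈ A)) D := ih fun x hx => by rw [h x hx]
    refine Set.ext fun t => ?_
    exact exists_congr fun A => by rw [key]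

/-- `D` and `E` are disjoint, so expansions of them can be chosen independently and glued; at depth
0 the only new pairs go from `D` to `E`. -/
theorem msoType_union (m : ℕ) {σ : Type} (c : C → σ) {D E : Set C}
    (h : ∀ x ∈ D, ∀ y ∈ E, x < y) :
    msoType m c (D ∪ E) = msoType m c D * msoType m c E := by
  induction m generalizing σ with
  | zero =>
    refine Prod.ext (Set.image_union _ _ _) ?_
    change {p | ∃ x ∈ D ∪ E, ∃ y ∈ D ∪ E, x < y ∧ (c x, c y) = p} =
      {p | ∃ x ∈ D, ∃ y ∈ D, x < y ∧ (c x, c y) = p} ∪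
      {p | ∃ x ∈ E, ∃ y ∈ E, x < y ∧ (c x, c y) = p} ∪ (c '' D) ×ˢ (c '' E)
    ext p
    constructor
    · rintro ⟨x, hx | hx, y, hy | hy, hxy, rfl⟩
      · exact Or.inl (Or.inl ⟨x, hx, y, hy, hxy, rfl⟩)
      · exact Or.inr ⟨⟨x, hx, rfl⟩, ⟨y, hy, rfl⟩⟩
      · exact absurd hxy (h y hy x hx).not_gt
      · exact Or.inl (Or.inr ⟨x, hx, y, hy, hxy, rfl⟩)
    · rintro ((⟨x, hx, y, hy, hxy, rfl⟩ | ⟨x, hx, y, hy, hxy, rfl⟩) | ⟨⟨x, hx, h1⟩, ⟨y, hy, h2⟩⟩)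
      · exact ⟨x, Or.inl hx, y, Or.inl hy, hxy, rfl⟩
      · exact ⟨x, Or.inr hx, y, Or.inr hy, hxy, rfl⟩
      · exact ⟨x, Or.inl hx, y, Or.inr hy, h x hx y hy, Prod.ext h1 h2⟩
  | succ m ih =>
    refine Set.ext fun t => ?_
    constructor
    · rintro ⟨A, rfl⟩
      exact Set.mem_mul.2 ⟨_, ⟨A, rfl⟩, _, ⟨A, rfl⟩, (ih _).symm⟩
    · intro ht
      obtain ⟨_, ⟨A, rfl⟩, _, ⟨B, rfl⟩, rfl⟩ := Set.mem_mul.1 ht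
      refine ⟨A ∩ D ∪ B ∩ E, ?_⟩
      rw [ih]
      congr 1
      · refine msoType_congr m fun x hx => Prod.ext rfl (propext ⟨?_, fun hA => Or.inl ⟨hA, hx⟩⟩)
        rintro (⟨hA, -⟩ | ⟨-, hE⟩)
        · exact hA
        · exact absurd (h x hx x hE) (lt_irrefl x)
      · refine msoType_congr m fun x hx => Prod.ext rfl (propext ⟨?_, fun hB => Or.inr ⟨hB, hx⟩⟩)
        rintro (⟨-, hD⟩ | ⟨hB, -⟩)
        · exact absurd (h x hD x hx) (lt_irrefl x)
        · exact hB

/-- The type of an ordered sum is determined by the types of the summands. -/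
theorem msoType_iUnion (m : ℕ) {I : Type*} [LinearOrder I] {σ : Type} {c c' : C → σ}
    {D D' : I → Set C} (hD : ∀ i j, i < j → ∀ x ∈ D i, ∀ y ∈ D j, x < y)
    (hD' : ∀ i j, i < j → ∀ x ∈ D' i, ∀ y ∈ D' j, x < y)
    (h : ∀ i, msoType m c (D i) = msoType m c' (D' i)) :
    msoType m c (⋃ i, D i) = msoType m c' (⋃ i, D' i) := by
  induction m generalizing σ D D' with
  | zero =>
    have main {c c' : C → σ} {D D' : I → Set C}
        (hD : ∀ i j, i < j → ∀ x ∈ D i, ∀ y ∈ D j, x < y)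
        (hD' : ∀ i j, i < j → ∀ x ∈ D' i, ∀ y ∈ D' j, x < y)
        (h : ∀ i, msoType 0 c (D i) = msoType 0 c' (D' i)) :
        c '' (⋃ i, D i) ⊆ c' '' (⋃ i, D' i) ∧
        {p | ∃ x ∈ ⋃ i, D i, ∃ y ∈ ⋃ i, D i, x < y ∧ (c x, c y) = p} ⊆
          {p | ∃ x ∈ ⋃ i, D' i, ∃ y ∈ ⋃ i, D' i, x < y ∧ (c' x, c' y) = p} := by
      have hl (i : I) : c '' D i = c' '' D' i := congrArg Prod.fst (h i)
      have hp (i : I) : {p | ∃ x ∈ D i, ∃ y ∈ D i, x < y ∧ (c x, c y) = p} =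
        {p | ∃ x ∈ D' i, ∃ y ∈ D' i, x < y ∧ (c' x, c' y) = p} := congrArg Prod.snd (h i)
      constructor
      · rw [Set.image_iUnion, Set.image_iUnion]
        exact Set.iUnion_mono fun i => (hl i).subset
      · rintro p ⟨x, hx, y, hy, hxy, rfl⟩
        obtain ⟨i, hx⟩ := Set.mem_iUnion.1 hx
        obtain ⟨j, hy⟩ := Set.mem_iUnion.1 hy
        rcases lt_trichotomy i j with hij | rfl | hij
        · obtain ⟨x', hx', hxx⟩ := (hl i).subset ⟨x, hx, rfl⟩
          obtain ⟨y', hy', hyy⟩ := (hl j).subset ⟨y, hy, rfl⟩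
          exact ⟨x', Set.mem_iUnion.2 ⟨i, hx'⟩, y', Set.mem_iUnion.2 ⟨j, hy'⟩,
            hD' i j hij x' hx' y' hy', Prod.ext hxx hyy⟩
        · obtain ⟨x', hx', y', hy', hlt, hxy'⟩ := (hp i).subset ⟨x, hx, y, hy, hxy, rfl⟩
          exact ⟨x', Set.mem_iUnion.2 ⟨i, hx'⟩, y', Set.mem_iUnion.2 ⟨i, hy'⟩, hlt, hxy'⟩
        · exact absurd hxy (hD j i hij y hy x hx).not_gt
    have h1 := main hD hD' h
    have h2 := main hD' hD fun i => (h i).symm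
    exact Prod.ext (h1.1.antisymm h2.1) (h1.2.antisymm h2.2)
  | succ m ih =>
    have main {c c' : C → σ} {D D' : I → Set C}
        (hD : ∀ i j, i < j → ∀ x ∈ D i, ∀ y ∈ D j, x < y)
        (hD' : ∀ i j, i < j → ∀ x ∈ D' i, ∀ y ∈ D' j, x < y)
        (h : ∀ i, msoType (m + 1) c (D i) = msoType (m + 1) c' (D' i)) (A : Set C) :
        ∃ B : Set C, msoType m (fun x => (c' x, x ∈ B)) (⋃ i, D' i) =
          msoType m (fun x => (c x, x ∈ A)) (⋃ i, D i) := by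
      have hB (i : I) : ∃ B : Set C, msoType m (fun x => (c' x, x ∈ B)) (D' i) =
          msoType m (fun x => (c x, x ∈ A)) (D i) :=
        exists_expansion_of_msoType_eq (h i) A
      choose B hB using hB
      -- The answers on the summands are glued; cutting each down to its own summand keeps them from
      -- interfering.
      refine ⟨⋃ i, B i ∩ D' i, ih hD' hD fun i => ?_⟩
      rw [← hB i]
      refine msoType_congr m fun x hx => Prod.ext rfl (propext
        ⟨fun hx' => ?_, fun hx' => Set.mem_iUnion.2 ⟨i, hx', hx⟩⟩)
      obtain ⟨j, hj, hxj⟩ := Set.mem_iUnion.1 hx'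
      rcases lt_trichotomy i j with hij | rfl | hij
      · exact absurd (hD' i j hij x hx x hxj) (lt_irrefl x)
      · exact hj
      · exact absurd (hD' j i hij x hxj x hx) (lt_irrefl x)
    refine Set.ext fun t => ?_
    constructor
    · rintro ⟨A, rfl⟩
      exact main hD hD' h A
    · rintro ⟨A, rfl⟩
      exact main hD' hD (fun i => (h i).symm) A

theorem msoType_singleton (m : ℕ) {σ : Type} {c c' : C → σ} {a b : C} (h : c a = c' b) :
    msoType m c {a} = msoType m c' {b} := by
  induction m generalizing σ with
  | zero =>
    have hp (c : C → σ) (a : C) :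
        {p | ∃ x ∈ ({a} : Set C), ∃ y ∈ ({a} : Set C), x < y ∧ (c x, c y) = p} = ∅ := by
      ext p
      simp
    refine Prod.ext ?_ ((hp c a).trans (hp c' b).symm)
    change c '' {a} = c' '' {b}
    rw [Set.image_singleton, Set.image_singleton, h]
  | succ m ih =>
    refine Set.ext fun t => ?_
    constructor
    · rintro ⟨A, rfl⟩
      -- Only the membership of one point matters, so the answering set is everything or empty.
      exact ⟨{_x | a ∈ A}, (ih (Prod.ext h rfl)).symm⟩
    · rintro ⟨A, rfl⟩
      exact ⟨{_x | b ∈ A}, ih (Prod.ext h rfl)⟩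

/-- Expanding by the empty set lowers the depth without losing letters. -/
theorem exists_letter_iff_of_msoType_eq {m : ℕ} {σ : Type} {c c' : C → σ} {D : Set C}
    (h : msoType m c D = msoType m c' D) (r : σ → Prop) :
    (∃ x ∈ D, r (c x)) ↔ ∃ x ∈ D, r (c' x) := by
  induction m generalizing σ with
  | zero =>
    have hl : c '' D = c' '' D := congrArg Prod.fst h
    simpa only [Set.exists_mem_image] using
      (show (∃ s ∈ c '' D, r s) ↔ ∃ s ∈ c' '' D, r s by rw [hl])
  | succ m ih =>
    obtain ⟨B, hB⟩ := exists_expansion_of_msoType_eq h ∅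
    exact (ih hB fun s => r s.1).symm

theorem exists_pair_iff_of_msoType_eq {m : ℕ} {σ : Type} {c c' : C → σ} {D : Set C}
    (h : msoType m c D = msoType m c' D) (r : σ → σ → Prop) :
    (∃ x ∈ D, ∃ y ∈ D, x < y ∧ r (c x) (c y)) ↔ ∃ x ∈ D, ∃ y ∈ D, x < y ∧ r (c' x) (c' y) := by
  induction m generalizing σ with
  | zero =>
    have hp : {p | ∃ x ∈ D, ∃ y ∈ D, x < y ∧ (c x, c y) = p} =
      {p | ∃ x ∈ D, ∃ y ∈ D, x < y ∧ (c' x, c' y) = p} := congrArg Prod.snd h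
    constructor
    · rintro ⟨x, hx, y, hy, hxy, hr⟩
      obtain ⟨x', hx', y', hy', hxy', he⟩ := hp.subset ⟨x, hx, y, hy, hxy, rfl⟩
      obtain ⟨h1, h2⟩ := Prod.mk.inj he
      rw [← h1, ← h2] at hr
      exact ⟨x', hx', y', hy', hxy', hr⟩
    · rintro ⟨x, hx, y, hy, hxy, hr⟩
      obtain ⟨x', hx', y', hy', hxy', he⟩ := hp.symm.subset ⟨x, hx, y, hy, hxy, rfl⟩
      obtain ⟨h1, h2⟩ := Prod.mk.inj he
      rw [← h1, ← h2] at hr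
      exact ⟨x', hx', y', hy', hxy', hr⟩
  | succ m ih =>
    obtain ⟨B, hB⟩ := exists_expansion_of_msoType_eq h ∅
    exact (ih hB fun s t => r s.1 t.1).symm

/-! ### Types determine satisfaction -/

namespace MonadicFormula

/-- Words of the same type of depth `m` satisfy the same formulas of depth at most `m`. The set
variables are read off the letters by the predicates `p`, the element variables by the
predicates `q`. -/
theorem sat_iff_of_msoType_eq {e s : ℕ} (φ : MonadicFormula e s) {m : ℕ} (hm : φ.depth ≤ m)
    {σ : Type} {c c' : C → σ} (h : msoType m c Set.univ = msoType m c' Set.univ)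
    (p : Fin s → σ → Prop) (q : Fin e → σ → Prop) {V V' : Fin s → Set C} {v v' : Fin e → C}
    (hV : ∀ X z, z ∈ V X ↔ p X (c z)) (hV' : ∀ X z, z ∈ V' X ↔ p X (c' z))
    (hv : ∀ x z, z = v x ↔ q x (c z)) (hv' : ∀ x z, z = v' x ↔ q x (c' z)) :
    φ.Sat v V ↔ φ.Sat v' V' := by
  induction φ generalizing m σ with
  | bot => rfl
  | eq x y =>
    have key := exists_letter_iff_of_msoType_eq h fun a => q x a ∧ q y a
    simp only [Set.mem_univ, true_and, ← hv, ← hv', exists_eq_left] at key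
    exact key
  | le x y =>
    have key := or_congr (exists_letter_iff_of_msoType_eq h fun a => q x a ∧ q y a)
      (exists_pair_iff_of_msoType_eq h fun a b => q x a ∧ q y b)
    simp only [Set.mem_univ, true_and, ← hv, ← hv', exists_eq_left] at key
    have aux (a b : C) : (∃ z w, z < w ∧ z = a ∧ w = b) ↔ a < b :=
      ⟨by rintro ⟨_, _, hlt, rfl, rfl⟩; exact hlt, fun hlt => ⟨a, b, hlt, rfl, rfl⟩⟩
    rw [aux, aux] at key
    simpa only [Sat, le_iff_eq_or_lt] using key
  | mem x X =>
    have key := exists_letter_iff_of_msoType_eq h fun a => q x a ∧ p X a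
    simp only [Set.mem_univ, true_and, ← hv, ← hv', ← hV, ← hV', exists_eq_left] at key
    exact key
  | subset X Y =>
    have key := not_congr (exists_letter_iff_of_msoType_eq h fun a => p X a ∧ ¬ p Y a)
    simp only [Set.mem_univ, true_and, ← hV, ← hV', not_exists, not_and, not_not] at key
    exact key
  | sing X =>
    have key := and_congr (exists_letter_iff_of_msoType_eq h fun a => p X a)
      (not_congr (exists_pair_iff_of_msoType_eq h fun a b => p X a ∧ p X b))
    simp only [Set.mem_univ, true_and, ← hV, ← hV'] at key
    have aux (A : Set C) : (∃ a, A = {a}) ↔ (∃ x, x ∈ A) ∧ ¬ ∃ x y, x < y ∧ x ∈ A ∧ y ∈ A := by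
      constructor
      · rintro ⟨a, rfl⟩
        refine ⟨⟨a, rfl⟩, ?_⟩
        rintro ⟨x, y, hxy, rfl, rfl⟩
        exact lt_irrefl _ hxy
      · rintro ⟨⟨a, ha⟩, hA⟩
        refine ⟨a, Set.eq_singleton_iff_unique_mem.2 ⟨ha, fun x hx => ?_⟩⟩
        rcases lt_trichotomy x a with hlt | rfl | hlt
        · exact absurd ⟨x, a, hlt, hx, ha⟩ hA
        · rfl
        · exact absurd ⟨a, x, hlt, ha, hx⟩ hA
    simpa only [Sat, aux] using key
  | not φ ih => exact not_congr (ih hm h p q hV hV' hv hv')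
  | and φ ψ ihφ ihψ =>
    exact and_congr (ihφ (le_of_max_le_left hm) h p q hV hV' hv hv')
      (ihψ (le_of_max_le_right hm) h p q hV hV' hv hv')
  | exElem φ ih =>
    have main {m : ℕ} (hm : φ.depth + 1 ≤ m) {c c' : C → σ} {V V' v v'}
        (h : msoType m c Set.univ = msoType m c' Set.univ)
        (hV : ∀ X z, z ∈ V X ↔ p X (c z)) (hV' : ∀ X z, z ∈ V' X ↔ p X (c' z))
        (hv : ∀ x z, z = v x ↔ q x (c z)) (hv' : ∀ x z, z = v' x ↔ q x (c' z))
        (hs : φ.exElem.Sat v V) : φ.exElem.Sat v' V' := by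
      obtain ⟨a, ha⟩ := hs
      obtain ⟨m, rfl⟩ : ∃ n, m = n + 1 := ⟨m - 1, by omega⟩
      -- An element is treated as a singleton set. The answer `B` is again a singleton: it has a
      -- point, and no increasing pair of points.
      obtain ⟨B, hB⟩ := exists_expansion_of_msoType_eq h {a}
      obtain ⟨b, -, hb⟩ :=
        (exists_letter_iff_of_msoType_eq hB fun s => s.2).2 ⟨a, Set.mem_univ a, rfl⟩
      have hpair := not_congr (exists_pair_iff_of_msoType_eq hB fun s t => s.2 ∧ t.2)
      have hBb (z : C) : z = b ↔ z ∈ B := by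
        refine ⟨fun hz => hz ▸ hb, fun hz => ?_⟩
        have hno := hpair.2 (by
          rintro ⟨x, -, y, -, hxy, hx, hy⟩
          exact hxy.ne (Eq.trans hx (Eq.symm hy)))
        rcases lt_trichotomy z b with hlt | rfl | hlt
        · exact absurd ⟨z, trivial, b, trivial, hlt, hz, hb⟩ hno
        · rfl
        · exact absurd ⟨b, trivial, z, trivial, hlt, hb, hz⟩ hno
      refine ⟨b, (ih (Nat.le_of_succ_le_succ hm) hB.symm (fun X s => p X s.1)
        (Fin.cons (fun s => s.2) fun x s => q x s.1) hV hV' ?_ ?_).1 ha⟩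
      · intro x z
        refine Fin.cases ?_ (fun x => ?_) x
        · exact Iff.rfl
        · exact hv x z
      · intro x z
        refine Fin.cases ?_ (fun x => ?_) x
        · exact hBb z
        · exact hv' x z
    exact ⟨main hm h hV hV' hv hv', main hm h.symm hV' hV hv' hv⟩
  | exSet φ ih =>
    have main {m : ℕ} (hm : φ.depth + 1 ≤ m) {c c' : C → σ} {V V' v v'}
        (h : msoType m c Set.univ = msoType m c' Set.univ)
        (hV : ∀ X z, z ∈ V X ↔ p X (c z)) (hV' : ∀ X z, z ∈ V' X ↔ p X (c' z))
        (hv : ∀ x z, z = v x ↔ q x (c z)) (hv' : ∀ x z, z = v' x ↔ q x (c' z))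
        (hs : φ.exSet.Sat v V) : φ.exSet.Sat v' V' := by
      obtain ⟨A, hA⟩ := hs
      obtain ⟨m, rfl⟩ : ∃ n, m = n + 1 := ⟨m - 1, by omega⟩
      obtain ⟨B, hB⟩ := exists_expansion_of_msoType_eq h A
      refine ⟨B, (ih (Nat.le_of_succ_le_succ hm) hB.symm
        (Fin.cons (fun s => s.2) fun X s => p X s.1) (fun x s => q x s.1) ?_ ?_ hv hv').1 hA⟩
      · intro X z
        refine Fin.cases ?_ (fun X => ?_) X
        · exact Iff.rfl
        · exact hV X z
      · intro X z
        refine Fin.cases ?_ (fun X => ?_) X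
        · exact Iff.rfl
        · exact hV' X z
    exact ⟨main hm h hV hV' hv hv', main hm h.symm hV' hV hv' hv⟩

end MonadicFormula

end Types

/-! ### A Ramsey argument -/

theorem exists_eventually_hyperfilter_eq {X : Type*} [Finite X] (f : ℕ → X) :
    ∃ x, ∀ᶠ n in (Filter.hyperfilter ℕ : Filter ℕ), f n = x := by
  obtain ⟨x, hx⟩ := Ultrafilter.eq_pure_of_finite ((Filter.hyperfilter ℕ).map f)
  exact ⟨x, show {x} ∈ (Filter.hyperfilter ℕ).map f by rw [hx]; rfl⟩

/-- A nonprincipal ultrafilter assigns a typical colour to the points and, for each `n`, to the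
pairs that start at `n`; typical points are then picked greedily. Consecutive pairs suffice for gaps
between neighbouring segments. -/
theorem exists_homogeneous_subseq {X Y : Type*} [Finite X] [Finite Y] (f : ℕ → X)
    (d : ℕ → ℕ → Y) :
    ∃ (g : ℕ → ℕ) (x : X) (y : Y), StrictMono g ∧ (∀ n, f (g n) = x) ∧
      ∀ n, d (g n) (g (n + 1)) = y := by
  obtain ⟨x, hx⟩ := exists_eventually_hyperfilter_eq f
  choose e he using fun n => exists_eventually_hyperfilter_eq (d n)
  obtain ⟨y, hy⟩ := exists_eventually_hyperfilter_eq e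
  have step (n : {n // f n = x ∧ e n = y}) :
      ∃ k : {n // f n = x ∧ e n = y}, n.1 < k.1 ∧ d n.1 k.1 = y := by
    have hgt : ∀ᶠ k in (Filter.hyperfilter ℕ : Filter ℕ), n.1 < k := by
      refine Filter.mem_hyperfilter_of_finite_compl ?_
      refine (Set.finite_Iic n.1).subset fun k hk => ?_
      simpa using hk
    obtain ⟨k, h1, h2, h3, h4⟩ := (hgt.and (hx.and (hy.and (he n.1)))).exists
    exact ⟨⟨k, h2, h3⟩, h1, h4.trans n.2.2⟩
  choose next hnext using step
  obtain ⟨n₀, h₀⟩ := (hx.and hy).exists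
  let g : ℕ → {n // f n = x ∧ e n = y} := fun n => Nat.rec ⟨n₀, h₀⟩ (fun _ k => next k) n
  exact ⟨fun n => (g n).1, x, y, strictMono_nat_of_lt_succ fun n => (hnext (g n)).1,
    fun n => (g n).2.1, fun n => (hnext (g n)).2⟩

/-! ### Ideals in finite monoids -/

section Monoid

variable {M : Type*} [Monoid M]

/-- The two-sided ideal generated by `t`. -/
def twoSidedMultiples (t : M) : Set M :=
  {s | ∃ a b, a * t * b = s}

theorem mem_twoSidedMultiples_self (t : M) : t ∈ twoSidedMultiples t :=
  ⟨1, 1, by simp⟩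

/-- In a finite monoid, a right multiple of `t` that generates the same two-sided ideal also
generates the same right ideal. -/
theorem exists_eq_mul_of_twoSidedMultiples [Finite M] {t y : M}
    (h : t ∈ twoSidedMultiples (t * y)) : ∃ x, t = t * y * x := by
  obtain ⟨a, b, hab⟩ := h
  have hpow (n : ℕ) : t = a ^ n * t * (y * b) ^ n := by
    induction n with
    | zero => simp
    | succ n ih =>
      calc t = a ^ n * t * (y * b) ^ n := ih
        _ = a ^ n * (a * (t * y) * b) * (y * b) ^ n := by rw [hab]
        _ = a ^ (n + 1) * t * (y * b) ^ (n + 1) := by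
          rw [pow_succ a, pow_succ' (y * b)]
          simp only [mul_assoc]
  -- Two powers of `a` coincide; trading the larger for the smaller leaves surplus factors `y * b`
  -- on the right.
  obtain ⟨i, j, hij, hpw⟩ : ∃ i j, i < j ∧ a ^ i = a ^ j := by
    obtain ⟨i, j, hne, he⟩ := Finite.exists_ne_map_eq_of_infinite fun n : ℕ => a ^ n
    rcases hne.lt_or_gt with hlt | hlt
    · exact ⟨i, j, hlt, he⟩
    · exact ⟨j, i, hlt, he.symm⟩
  obtain ⟨k, rfl⟩ := Nat.exists_eq_add_of_lt hij
  refine ⟨b * (y * b) ^ k, ?_⟩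
  calc t = a ^ i * t * (y * b) ^ (i + k + 1) := by rw [hpw]; exact hpow _
    _ = a ^ i * t * (y * b) ^ i * (y * b) ^ (k + 1) := by
      rw [add_assoc, pow_add]; simp only [mul_assoc]
    _ = t * (y * b) ^ (k + 1) := by rw [← hpow i]
    _ = t * y * (b * (y * b) ^ k) := by rw [pow_succ']; simp only [mul_assoc]

theorem ncard_twoSidedMultiples_lt [Finite M] {t y : M} (h : ¬ ∃ x, t = t * y * x) :
    (twoSidedMultiples (t * y)).ncard < (twoSidedMultiples t).ncard := by
  refine Set.ncard_lt_ncard ⟨?_, fun hsub => h (exists_eq_mul_of_twoSidedMultiples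
    (hsub (mem_twoSidedMultiples_self t)))⟩ (Set.toFinite _)
  rintro _ ⟨a, b, rfl⟩
  exact ⟨a, y * b, by simp only [mul_assoc]⟩

theorem ncard_twoSidedMultiples_op (t : M) :
    (twoSidedMultiples (MulOpposite.op t)).ncard = (twoSidedMultiples t).ncard := by
  have himg : twoSidedMultiples (MulOpposite.op t) = MulOpposite.op '' twoSidedMultiples t := by
    ext s
    constructor
    · rintro ⟨a, b, rfl⟩
      exact ⟨b.unop * t * a.unop, ⟨_, _, rfl⟩, by simp [mul_assoc]⟩
    · rintro ⟨_, ⟨a, b, rfl⟩, rfl⟩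
      exact ⟨MulOpposite.op b, MulOpposite.op a, by simp [mul_assoc]⟩
  rw [himg, Set.ncard_image_of_injective _ MulOpposite.op_injective]

end Monoid

/-! ### Segment types and uniform sequences -/

/-- An assignment of elements of a monoid to the segments `D` of a chain expanded by a subset `A`,
compatible with sums of two segments and of sequences of segments. -/
structure SegmentType (C : Type u) [LinearOrder C] (M : Type*) [Monoid M] where
  /-- the type of the segment `D` in the expansion by `A` -/
  tp : Set C → Set C → M
  congr : ∀ {A A' D : Set C}, (∀ x ∈ D, x ∈ A ↔ x ∈ A') → tp A D = tp A' D
  union : ∀ {A D E : Set C}, (∀ x ∈ D, ∀ y ∈ E, x < y) → tp A (D ∪ E) = tp A D * tp A E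
  iUnion_increasing : ∀ {A : Set C} {D D' : ℕ → Set C},
    (∀ i j, i < j → ∀ x ∈ D i, ∀ y ∈ D j, x < y) →
    (∀ i j, i < j → ∀ x ∈ D' i, ∀ y ∈ D' j, x < y) →
    (∀ i, tp A (D i) = tp A (D' i)) → tp A (⋃ i, D i) = tp A (⋃ i, D' i)
  iUnion_decreasing : ∀ {A : Set C} {D D' : ℕ → Set C},
    (∀ i j, i < j → ∀ x ∈ D i, ∀ y ∈ D j, y < x) →
    (∀ i j, i < j → ∀ x ∈ D' i, ∀ y ∈ D' j, y < x) →
    (∀ i, tp A (D i) = tp A (D' i)) → tp A (⋃ i, D i) = tp A (⋃ i, D' i)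

namespace SegmentType

variable {C : Type u} [LinearOrder C] {M : Type*} [Monoid M] {K : Type*}

/-- The assignment for the reversed chain, in the opposite monoid. -/
def dual (T : SegmentType C M) : SegmentType Cᵒᵈ Mᵐᵒᵖ where
  tp A D := MulOpposite.op (T.tp (OrderDual.toDual ⁻¹' A) (OrderDual.toDual ⁻¹' D))
  congr h := congrArg MulOpposite.op (T.congr fun x hx => h (OrderDual.toDual x) hx)
  union {A D E} h := by
    rw [← MulOpposite.op_mul, Set.preimage_union, Set.union_comm]
    exact congrArg MulOpposite.op (T.union fun x hx y hy => h y hy x hx)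
  iUnion_increasing h h' he := by
    rw [Set.preimage_iUnion, Set.preimage_iUnion]
    exact congrArg MulOpposite.op (T.iUnion_decreasing (fun i j hij x hx y hy => h i j hij x hx y hy)
      (fun i j hij x hx y hy => h' i j hij x hx y hy) fun i => MulOpposite.op_injective (he i))
  iUnion_decreasing h h' he := by
    rw [Set.preimage_iUnion, Set.preimage_iUnion]
    exact congrArg MulOpposite.op (T.iUnion_increasing (fun i j hij x hx y hy => h i j hij x hx y hy)
      (fun i j hij x hx y hy => h' i j hij x hx y hy) fun i => MulOpposite.op_injective (he i))

/-- There is a nonempty set `A` none of whose elements is singled out by its label and the types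
of the two segments that it cuts off. -/
def Blurred (T : SegmentType C M) (lab : C → K) : Prop :=
  ∃ A : Set C, A.Nonempty ∧ ∀ a ∈ A, ∃ b ∈ A, a ≠ b ∧ lab a = lab b ∧
    T.tp A (Set.Iio a) = T.tp A (Set.Iio b) ∧ T.tp A (Set.Ioi a) = T.tp A (Set.Ioi b)

theorem Blurred.of_dual {T : SegmentType C M} {lab : C → K}
    (h : T.dual.Blurred (fun x : Cᵒᵈ => lab (OrderDual.ofDual x))) : T.Blurred lab := by
  obtain ⟨A, ⟨a, ha⟩, hA⟩ := h
  refine ⟨OrderDual.toDual ⁻¹' A, ⟨OrderDual.ofDual a, ha⟩, fun a ha => ?_⟩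
  obtain ⟨b, hb, hne, hl, h1, h2⟩ := hA (OrderDual.toDual a) ha
  exact ⟨OrderDual.ofDual b, hb, hne, hl, MulOpposite.op_injective h2,
    MulOpposite.op_injective h1⟩

/-- The elements strictly between the segments `D` and `E`. -/
def gap (D E : Set C) : Set C :=
  {x | (∀ y ∈ D, y < x) ∧ ∀ z ∈ E, x < z}

/-- An increasing sequence of segments `E i` with subsets `A i` of the same kind, such that the
gaps between consecutive segments have the same type. -/
structure UniformSeq (T : SegmentType C M) (lab : C → K) where
  /-- the segments -/
  E : ℕ → Set C
  /-- the subsets -/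
  A : ℕ → Set C
  /-- the type of the segments -/
  t : M
  /-- the type of the gaps -/
  q : M
  ordConnected : ∀ i, (E i).OrdConnected
  lt : ∀ i j, i < j → ∀ x ∈ E i, ∀ y ∈ E j, x < y
  subset : ∀ i, A i ⊆ E i
  nonempty : ∀ i, (A i).Nonempty
  tp_eq : ∀ i, T.tp (A i) (E i) = t
  tp_gap : ∀ i, T.tp ∅ (gap (E i) (E (i + 1))) = q
  similar : ∀ i j, ∀ a ∈ A i, ∃ b ∈ A j, lab a = lab b ∧
    T.tp (A i) (E i ∩ Set.Iio a) = T.tp (A j) (E j ∩ Set.Iio b) ∧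
    T.tp (A i) (E i ∩ Set.Ioi a) = T.tp (A j) (E j ∩ Set.Ioi b)

/-- The colour of a segment is its type together with the set of kinds of its chosen elements;
constancy of that set is `similar`. -/
theorem exists_uniformSeq [Finite M] [Finite K] (T : SegmentType C M) (lab : C → K)
    (E A : ℕ → Set C) (hE : ∀ i, (E i).OrdConnected)
    (hlt : ∀ i j, i < j → ∀ x ∈ E i, ∀ y ∈ E j, x < y) (hsub : ∀ i, A i ⊆ E i)
    (hne : ∀ i, (A i).Nonempty) :
    ∃ (U : UniformSeq T lab) (g : ℕ → ℕ), (∀ i, U.E i = E (g i)) ∧ ∀ i, U.A i = A (g i) := by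
  let kind (i : ℕ) (a : C) : K × M × M :=
    (lab a, T.tp (A i) (E i ∩ Set.Iio a), T.tp (A i) (E i ∩ Set.Ioi a))
  obtain ⟨g, ⟨t, R⟩, q, hg, ht, hq⟩ := exists_homogeneous_subseq
    (fun i => (T.tp (A i) (E i), kind i '' A i)) (fun i j => T.tp ∅ (gap (E i) (E j)))
  refine ⟨⟨E ∘ g, A ∘ g, t, q, fun i => hE _, fun i j hij => hlt _ _ (hg hij), fun i => hsub _,
    fun i => hne _, fun i => congrArg Prod.fst (ht i), hq, fun i j a ha => ?_⟩, g,
    fun _ => rfl, fun _ => rfl⟩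
  have hR : kind (g i) '' A (g i) = kind (g j) '' A (g j) :=
    (congrArg Prod.snd (ht i)).trans (congrArg Prod.snd (ht j)).symm
  obtain ⟨b, hb, he⟩ := hR.subset ⟨a, ha, rfl⟩
  exact ⟨b, hb, (congrArg Prod.fst he).symm, (congrArg (fun p => p.2.1) he).symm,
    (congrArg (fun p => p.2.2) he).symm⟩

theorem union_inter_Iio_left {D E : Set C} (h : ∀ x ∈ D, ∀ y ∈ E, x < y) {a : C} (ha : a ∈ D) :
    (D ∪ E) ∩ Set.Iio a = D ∩ Set.Iio a := by
  ext x
  constructor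
  · rintro ⟨hx | hx, hxa⟩
    · exact ⟨hx, hxa⟩
    · exact absurd (h a ha x hx) (not_lt_of_gt hxa)
  · rintro ⟨hx, hxa⟩
    exact ⟨Or.inl hx, hxa⟩

theorem union_inter_Ioi_left {D E : Set C} (h : ∀ x ∈ D, ∀ y ∈ E, x < y) {a : C} (ha : a ∈ D) :
    (D ∪ E) ∩ Set.Ioi a = D ∩ Set.Ioi a ∪ E := by
  ext x
  constructor
  · rintro ⟨hx | hx, hxa⟩
    · exact Or.inl ⟨hx, hxa⟩
    · exact Or.inr hx
  · rintro (⟨hx, hxa⟩ | hx)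
    · exact ⟨Or.inl hx, hxa⟩
    · exact ⟨Or.inr hx, h a ha x hx⟩

theorem union_inter_Iio_right {D E : Set C} (h : ∀ x ∈ D, ∀ y ∈ E, x < y) {a : C} (ha : a ∈ E) :
    (D ∪ E) ∩ Set.Iio a = D ∪ E ∩ Set.Iio a := by
  ext x
  constructor
  · rintro ⟨hx | hx, hxa⟩
    · exact Or.inl hx
    · exact Or.inr ⟨hx, hxa⟩
  · rintro (hx | ⟨hx, hxa⟩)
    · exact ⟨Or.inl hx, h x hx a ha⟩
    · exact ⟨Or.inr hx, hxa⟩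

theorem union_inter_Ioi_right {D E : Set C} (h : ∀ x ∈ D, ∀ y ∈ E, x < y) {a : C} (ha : a ∈ E) :
    (D ∪ E) ∩ Set.Ioi a = E ∩ Set.Ioi a := by
  ext x
  constructor
  · rintro ⟨hx | hx, hxa⟩
    · exact absurd (h x hx a ha) (not_lt_of_gt hxa)
    · exact ⟨hx, hxa⟩
  · rintro ⟨hx, hxa⟩
    exact ⟨Or.inr hx, hxa⟩

namespace UniformSeq

variable {T : SegmentType C M} {lab : C → K} (U : UniformSeq T lab)

/-- The union of the subsets. -/
def total : Set C := ⋃ i, U.A i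

/-- A segment together with the gap after it. -/
def block (n : ℕ) : Set C := U.E n ∪ gap (U.E n) (U.E (n + 1))

/-- The convex hull of the segments from the `n`-th one on. -/
def tail (n : ℕ) : Set C :=
  {x | (∃ y ∈ U.E n, y ≤ x) ∧ ∃ m, ∃ y ∈ U.E m, x ≤ y}

theorem exists_mem (n : ℕ) : ∃ x, x ∈ U.E n :=
  (U.nonempty n).mono (U.subset n)

theorem ordConnected_tail (n : ℕ) : (U.tail n).OrdConnected := by
  refine ⟨?_⟩
  rintro x ⟨⟨y, hy, hyx⟩, -⟩ x' ⟨-, m, y', hy', hxy'⟩ z ⟨hxz, hzx'⟩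
  exact ⟨⟨y, hy, hyx.trans hxz⟩, m, y', hy', hzx'.trans hxy'⟩

theorem tail_subset {S : Set C} [S.OrdConnected] (h : ∀ i, U.E i ⊆ S) (n : ℕ) :
    U.tail n ⊆ S := by
  rintro x ⟨⟨y, hy, hyx⟩, m, y', hy', hxy'⟩
  exact Set.Icc_subset S (h n hy) (h m hy') ⟨hyx, hxy'⟩

theorem lt_gap (n : ℕ) : ∀ x ∈ U.E n, ∀ y ∈ gap (U.E n) (U.E (n + 1)), x < y :=
  fun x hx _ hy => hy.1 x hx

theorem block_lt_tail (n : ℕ) : ∀ x ∈ U.block n, ∀ y ∈ U.tail (n + 1), x < y := by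
  rintro x (hx | hx) y ⟨⟨z, hz, hzy⟩, -⟩
  · exact (U.lt n (n + 1) n.lt_succ_self x hx z hz).trans_le hzy
  · exact (hx.2 z hz).trans_le hzy

theorem segment_subset_tail (n : ℕ) : U.E n ⊆ U.tail n :=
  fun x hx => ⟨⟨x, hx, le_rfl⟩, n, x, hx, le_rfl⟩

theorem tail_eq_union (n : ℕ) : U.tail n = U.block n ∪ U.tail (n + 1) := by
  obtain ⟨e, he⟩ := U.exists_mem n
  obtain ⟨e', he'⟩ := U.exists_mem (n + 1)
  ext x
  constructor
  · rintro ⟨⟨y, hy, hyx⟩, hm⟩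
    by_cases h1 : ∃ z ∈ U.E (n + 1), z ≤ x
    · exact Or.inr ⟨h1, hm⟩
    by_cases h2 : ∃ z ∈ U.E n, x ≤ z
    · obtain ⟨z, hz, hxz⟩ := h2
      exact Or.inl (Or.inl ((U.ordConnected n).out hy hz ⟨hyx, hxz⟩))
    · push Not at h1 h2
      exact Or.inl (Or.inr ⟨h2, h1⟩)
  · rintro ((hx | hx) | ⟨⟨y, hy, hyx⟩, hm⟩)
    · exact U.segment_subset_tail n hx
    · exact ⟨⟨e, he, (hx.1 e he).le⟩, n + 1, e', he', (hx.2 e' he').le⟩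
    · exact ⟨⟨e, he, ((U.lt n (n + 1) n.lt_succ_self e he y hy).trans_le hyx).le⟩, hm⟩

theorem block_subset_tail (n k : ℕ) : U.block (n + k) ⊆ U.tail n := by
  induction k generalizing n with
  | zero =>
    rw [U.tail_eq_union]
    exact Set.subset_union_left
  | succ k ih =>
    rw [U.tail_eq_union, show n + (k + 1) = n + 1 + k by omega]
    exact (ih (n + 1)).trans Set.subset_union_right

theorem tail_eq_iUnion (n : ℕ) : U.tail n = ⋃ i, U.block (n + i) := by
  refine Set.Subset.antisymm (fun x hx => ?_) (Set.iUnion_subset fun i => U.block_subset_tail n i)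
  by_contra hno
  have hall (k : ℕ) : x ∈ U.tail (n + k) := by
    induction k with
    | zero => exact hx
    | succ k ih =>
      rw [U.tail_eq_union] at ih
      exact ih.resolve_left fun hb => hno (Set.mem_iUnion.2 ⟨k, hb⟩)
  obtain ⟨-, m, y, hy, hxy⟩ := hx
  obtain ⟨⟨z, hz, hzx⟩, -⟩ := hall (m + 1)
  exact absurd (U.lt m (n + (m + 1)) (by omega) y hy z hz) (hzx.trans hxy).not_gt

theorem block_lt_block (i j : ℕ) (hij : i < j) : ∀ x ∈ U.block i, ∀ y ∈ U.block j, x < y := by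
  obtain ⟨k, rfl⟩ := Nat.exists_eq_add_of_lt hij
  intro x hx y hy
  refine U.block_lt_tail i x hx y (U.block_subset_tail (i + 1) k ?_)
  rwa [show i + 1 + k = i + k + 1 by omega]

theorem mem_total_iff {n : ℕ} {x : C} (hx : x ∈ U.E n) : x ∈ U.total ↔ x ∈ U.A n := by
  refine ⟨fun h => ?_, fun h => Set.mem_iUnion.2 ⟨n, h⟩⟩
  obtain ⟨j, hj⟩ := Set.mem_iUnion.1 h
  rcases lt_trichotomy n j with hlt | rfl | hlt
  · exact absurd (U.lt n j hlt x hx x (U.subset j hj)) (lt_irrefl x)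
  · exact hj
  · exact absurd (U.lt j n hlt x (U.subset j hj) x hx) (lt_irrefl x)

theorem tp_total_of_subset {n : ℕ} {D : Set C} (hD : D ⊆ U.E n) :
    T.tp U.total D = T.tp (U.A n) D :=
  T.congr fun _ hx => U.mem_total_iff (hD hx)

theorem tp_total_gap (n : ℕ) : T.tp U.total (gap (U.E n) (U.E (n + 1))) = U.q := by
  rw [← U.tp_gap n]
  refine T.congr fun x hx => ⟨fun h => ?_, fun h => h.elim⟩
  obtain ⟨j, hj⟩ := Set.mem_iUnion.1 h
  have hxj := U.subset j hj
  obtain ⟨e, he⟩ := U.exists_mem n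
  obtain ⟨e', he'⟩ := U.exists_mem (n + 1)
  rcases lt_trichotomy j n with hlt | rfl | hlt
  · exact absurd ((U.lt j n hlt x hxj e he).trans (hx.1 e he)) (lt_irrefl x)
  · exact absurd (hx.1 x hxj) (lt_irrefl x)
  · rcases (Nat.succ_le_of_lt hlt).eq_or_lt with h' | h'
    · subst h'
      exact absurd (hx.2 x hxj) (lt_irrefl x)
    · exact absurd ((hx.2 e' he').trans (U.lt (n + 1) j h' e' he' x hxj)) (lt_irrefl x)

theorem tp_total_block (n : ℕ) : T.tp U.total (U.block n) = U.t * U.q := by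
  rw [block, T.union (U.lt_gap n), U.tp_total_gap, U.tp_total_of_subset Set.Subset.rfl, U.tp_eq]

/-- Every tail is a sum of a sequence of blocks of type `t * q`, wherever it starts. -/
theorem tp_total_tail (n : ℕ) : T.tp U.total (U.tail n) = T.tp U.total (U.tail 0) := by
  rw [U.tail_eq_iUnion, U.tail_eq_iUnion]
  exact T.iUnion_increasing (fun i j hij => U.block_lt_block _ _ (by omega))
    (fun i j hij => U.block_lt_block _ _ (by omega))
    fun i => by rw [U.tp_total_block, U.tp_total_block]

theorem tp_total_tail_eq_mul :
    T.tp U.total (U.tail 0) = U.t * (U.q * T.tp U.total (U.tail 0)) := by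
  conv_lhs => rw [U.tail_eq_union, T.union (U.block_lt_tail 0), U.tp_total_block, U.tp_total_tail]
  rw [mul_assoc]

theorem tp_tail_inter_Ioi {n : ℕ} {a : C} (ha : a ∈ U.E n) (k : ℕ) (hk : k ≤ n) :
    T.tp U.total (U.tail k ∩ Set.Ioi a) =
      T.tp (U.A n) (U.E n ∩ Set.Ioi a) * (U.q * T.tp U.total (U.tail 0)) := by
  induction hk using Nat.decreasingInduction with
  | self =>
    rw [U.tail_eq_union, union_inter_Ioi_left (U.block_lt_tail n) (Or.inl ha),
      T.union fun x hx => U.block_lt_tail n x hx.1, block, union_inter_Ioi_left (U.lt_gap n) ha,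
      T.union fun x hx => U.lt_gap n x hx.1, U.tp_total_gap, U.tp_total_tail,
      U.tp_total_of_subset Set.inter_subset_left, mul_assoc]
  | of_succ k hk ih =>
    obtain ⟨j, rfl⟩ := Nat.exists_eq_add_of_lt hk
    rw [U.tail_eq_union, union_inter_Ioi_right (U.block_lt_tail k), ih]
    refine U.block_subset_tail (k + 1) j ?_
    rw [show k + 1 + j = k + j + 1 by omega]
    exact Or.inl ha

/-- Each step back from `n` to `k` puts a block of type `t * q` in front, which `h` absorbs. -/
theorem tp_tail_inter_Iio {n : ℕ} {a : C} (ha : a ∈ U.E n)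
    (h : U.t * U.q * T.tp (U.A n) (U.E n ∩ Set.Iio a) = T.tp (U.A n) (U.E n ∩ Set.Iio a))
    (k : ℕ) (hk : k ≤ n) :
    T.tp U.total (U.tail k ∩ Set.Iio a) = T.tp (U.A n) (U.E n ∩ Set.Iio a) := by
  induction hk using Nat.decreasingInduction with
  | self =>
    rw [U.tail_eq_union, union_inter_Iio_left (U.block_lt_tail n) (Or.inl ha), block,
      union_inter_Iio_left (U.lt_gap n) ha, U.tp_total_of_subset Set.inter_subset_left]
  | of_succ k hk ih =>
    have hmem : a ∈ U.tail (k + 1) := by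
      obtain ⟨j, rfl⟩ := Nat.exists_eq_add_of_lt hk
      refine U.block_subset_tail (k + 1) j ?_
      rw [show k + 1 + j = k + j + 1 by omega]
      exact Or.inl ha
    rw [U.tail_eq_union, union_inter_Iio_right (U.block_lt_tail k) hmem,
      T.union fun x hx y hy => U.block_lt_tail k x hx y hy.1, ih, U.tp_total_block, h]

/-- If the type of the whole sum generates the same right ideal as the type of a segment, then the
elements of corresponding positions in the segments cannot be told apart. -/
theorem blurred (hleft : ∀ i, ∀ a ∈ U.A i, ∃ x, T.tp (U.A i) (U.E i ∩ Set.Iio a) = U.t * x)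
    (hright : ∃ x, U.t = T.tp U.total (U.tail 0) * x) : T.Blurred lab := by
  -- With s the type of the tail, t = s x and s = t q s give t q t = t q s x = s x = t.
  have habs : U.t * U.q * U.t = U.t := by
    obtain ⟨x, hx⟩ := hright
    calc U.t * U.q * U.t = U.t * (U.q * T.tp U.total (U.tail 0)) * x := by
          conv_lhs => rw [hx]
          conv_rhs => rw [hx]
          simp only [mul_assoc]
      _ = U.t := by rw [← U.tp_total_tail_eq_mul, ← hx]
  have htail (n : ℕ) : U.E n ⊆ U.tail 0 := by
    have := U.block_subset_tail 0 n
    rw [zero_add] at this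
    exact Set.subset_union_left.trans this
  have hI {n : ℕ} {a : C} (ha : a ∈ U.A n) :
      U.t * U.q * T.tp (U.A n) (U.E n ∩ Set.Iio a) = T.tp (U.A n) (U.E n ∩ Set.Iio a) := by
    obtain ⟨x, hx⟩ := hleft n a ha
    rw [hx, ← mul_assoc, habs]
  let X : Set C := {x | ∀ y ∈ U.tail 0, x < y}
  let Y : Set C := {x | ∀ y ∈ U.tail 0, y < x}
  obtain ⟨e, he⟩ := U.exists_mem 0
  have hXF : ∀ x ∈ X, ∀ y ∈ U.tail 0, x < y := fun x hx => hx
  have hXFY : ∀ x ∈ X ∪ U.tail 0, ∀ y ∈ Y, x < y := by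
    rintro x (hx | hx) y hy
    · exact (hx e (htail 0 he)).trans (hy e (htail 0 he))
    · exact hy x hx
  have huniv : X ∪ U.tail 0 ∪ Y = Set.univ := by
    refine Set.eq_univ_of_forall fun x => ?_
    by_cases h1 : ∃ y ∈ U.tail 0, y ≤ x
    · by_cases h2 : ∃ y ∈ U.tail 0, x ≤ y
      · obtain ⟨y, hy, hyx⟩ := h1
        obtain ⟨y', hy', hxy'⟩ := h2
        exact Or.inl (Or.inr ((U.ordConnected_tail 0).out hy hy' ⟨hyx, hxy'⟩))
      · push Not at h2
        exact Or.inr h2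
    · push Not at h1
      exact Or.inl (Or.inl h1)
  have hIio {n : ℕ} {a : C} (ha : a ∈ U.A n) : T.tp U.total (Set.Iio a) =
      T.tp U.total X * T.tp (U.A n) (U.E n ∩ Set.Iio a) := by
    have haE := U.subset n ha
    have he : Set.Iio a = X ∪ U.tail 0 ∩ Set.Iio a := by
      rw [← union_inter_Iio_right hXF (htail n haE),
        ← union_inter_Iio_left hXFY (Or.inr (htail n haE)), huniv, Set.univ_inter]
    conv_lhs => rw [he, T.union fun x hx y hy => hXF x hx y hy.1]
    rw [U.tp_tail_inter_Iio haE (hI ha) 0 n.zero_le]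
  have hIoi {n : ℕ} {a : C} (ha : a ∈ U.A n) : T.tp U.total (Set.Ioi a) =
      T.tp (U.A n) (U.E n ∩ Set.Ioi a) * (U.q * T.tp U.total (U.tail 0)) * T.tp U.total Y := by
    have haE := U.subset n ha
    have he : Set.Ioi a = U.tail 0 ∩ Set.Ioi a ∪ Y := by
      rw [← union_inter_Ioi_right hXF (htail n haE),
        ← union_inter_Ioi_left hXFY (Or.inr (htail n haE)), huniv, Set.univ_inter]
    conv_lhs => rw [he, T.union fun x hx y hy => hXFY x (Or.inr hx.1) y hy]
    rw [U.tp_tail_inter_Ioi haE 0 n.zero_le]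
  refine ⟨U.total, (U.nonempty 0).mono (Set.subset_iUnion U.A 0), fun a ha => ?_⟩
  obtain ⟨n, ha⟩ := Set.mem_iUnion.1 ha
  obtain ⟨b, hb, hl, h1, h2⟩ := U.similar n (n + 1) a ha
  -- The partner lies in the next segment, hence differs from `a`.
  refine ⟨b, Set.mem_iUnion.2 ⟨n + 1, hb⟩, (U.lt n (n + 1) n.lt_succ_self a (U.subset n ha) b
    (U.subset _ hb)).ne, hl, ?_, ?_⟩
  · rw [hIio ha, hIio hb, h1]
  · rw [hIoi ha, hIoi hb, h2]

end UniformSeq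

end SegmentType

/-! ### Nested sums and descent of ideals -/

/-- The segment `S` contains a nested sum of height `k`, along increasing sequences on the outside
and alternately along increasing and decreasing sequences inside. -/
def UpTree : ℕ → (C : Type u) → [LinearOrder C] → Set C → Prop
  | 0, _, _, S => S.Nonempty
  | k + 1, C, _, S => ∃ D : ℕ → Set C, (∀ i, D i ⊆ S ∧ (D i).OrdConnected) ∧
      (∀ i j, i < j → ∀ x ∈ D i, ∀ y ∈ D j, x < y) ∧
      ∀ i, UpTree k Cᵒᵈ (OrderDual.ofDual ⁻¹' D i)

namespace SegmentType

/-- Each level after the first removes at least one element from the ideal. The clause on `Set.Ioi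
a`, read in the reversed chain, is the hypothesis `hleft` of `UniformSeq.blurred` one level up. -/
theorem exists_segment_of_upTree (k : ℕ) {C : Type u} [LinearOrder C] {M : Type*} [Monoid M]
    [Finite M] {K : Type*} [Finite K] (T : SegmentType C M) (lab : C → K)
    (hT : ¬ T.Blurred lab) {S : Set C} (hS : S.OrdConnected) (h : UpTree (k + 1) C S) :
    ∃ E A : Set C, E ⊆ S ∧ E.OrdConnected ∧ A ⊆ E ∧ A.Nonempty ∧
      (∀ a ∈ A, ∃ x, T.tp A (E ∩ Set.Ioi a) = x * T.tp A E) ∧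
      (twoSidedMultiples (T.tp A E)).ncard + k ≤ Nat.card M := by
  have main (U : UniformSeq T lab) (hU : ∀ i, U.E i ⊆ S)
      (hcard : (twoSidedMultiples (T.tp U.total (U.tail 0))).ncard + k ≤ Nat.card M) :
      ∃ E A : Set C, E ⊆ S ∧ E.OrdConnected ∧ A ⊆ E ∧ A.Nonempty ∧
      (∀ a ∈ A, ∃ x, T.tp A (E ∩ Set.Ioi a) = x * T.tp A E) ∧
      (twoSidedMultiples (T.tp A E)).ncard + k ≤ Nat.card M := by
    refine ⟨U.tail 0, U.total, U.tail_subset hU 0, U.ordConnected_tail 0, ?_,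
      (U.nonempty 0).mono (Set.subset_iUnion U.A 0), fun a ha => ?_, hcard⟩
    · refine Set.iUnion_subset fun n => (U.subset n).trans ?_
      have := U.block_subset_tail 0 n
      rw [zero_add] at this
      exact Set.subset_union_left.trans this
    · obtain ⟨n, hn⟩ := Set.mem_iUnion.1 ha
      refine ⟨T.tp (U.A n) (U.E n ∩ Set.Ioi a) * U.q, ?_⟩
      rw [U.tp_tail_inter_Ioi (U.subset n hn) 0 n.zero_le, mul_assoc]
  obtain ⟨D, hD, hlt, htree⟩ := h
  cases k with
  | zero =>
    -- A single point is no base: the type of the empty part to its right need not be a left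
    -- multiple of its own type. An increasing sequence of points is.
    choose p hp using htree
    obtain ⟨U, g, hUE, hUA⟩ := exists_uniformSeq T lab (fun i => {(p i : C)}) (fun i => {(p i : C)})
      (fun i => Set.ordConnected_singleton)
      (fun i j hij x hx y hy => hlt i j hij x (hx ▸ hp i) y (hy ▸ hp j))
      (fun i => Set.Subset.rfl) (fun i => Set.singleton_nonempty _)
    refine main U (fun i => ?_) (Set.ncard_le_card _)
    rw [hUE]
    exact Set.singleton_subset_iff.2 ((hD _).1 (hp _))
  | succ k =>
    have : Finite Mᵐᵒᵖ := Finite.of_equiv M MulOpposite.opEquiv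
    have hdual : ¬ T.dual.Blurred (fun x : Cᵒᵈ => lab (OrderDual.ofDual x)) :=
      fun hb => hT hb.of_dual
    have hseg (i : ℕ) : ∃ E A : Set C, E ⊆ D i ∧ E.OrdConnected ∧ A ⊆ E ∧ A.Nonempty ∧
        (∀ a ∈ A, ∃ x, T.tp A (E ∩ Set.Iio a) = T.tp A E * x) ∧
        (twoSidedMultiples (T.tp A E)).ncard + k ≤ Nat.card M := by
      obtain ⟨E, A, hED, hE, hAE, hA, hx, hc⟩ := exists_segment_of_upTree k T.dual
        (fun x : Cᵒᵈ => lab (OrderDual.ofDual x)) hdual (hD i).2.dual (htree i)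
      refine ⟨OrderDual.toDual ⁻¹' E, OrderDual.toDual ⁻¹' A, hED, hE.dual, hAE, hA,
        fun a ha => ?_, ?_⟩
      · obtain ⟨x, hx⟩ := hx (OrderDual.toDual a) ha
        exact ⟨x.unop, congrArg MulOpposite.unop hx⟩
      · rw [← ncard_twoSidedMultiples_op]
        refine hc.trans_eq ?_
        exact Nat.card_congr MulOpposite.opEquiv.symm
    choose E A hED hE hAE hA hleft hcard using hseg
    obtain ⟨U, g, hUE, hUA⟩ := exists_uniformSeq T lab E A hE
      (fun i j hij x hx y hy => hlt i j hij x (hED i hx) y (hED j hy)) hAE hA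
    refine main U (fun i => ?_) ?_
    · rw [hUE]
      exact (hED _).trans (hD _).1
    -- Otherwise the sequence already yields a blurred set.
    · have hne : ¬ ∃ x, U.t = T.tp U.total (U.tail 0) * x := fun hx => by
        refine hT (U.blurred (fun i a ha => ?_) hx)
        rw [← U.tp_eq i, hUA, hUE]
        rw [hUA] at ha
        exact hleft _ a ha
      have ht := hcard (g 0)
      rw [← hUE, ← hUA, U.tp_eq] at ht
      rw [U.tp_total_tail_eq_mul] at hne ⊢
      have := ncard_twoSidedMultiples_lt hne
      omega

theorem blurred_of_upTree {C : Type u} [LinearOrder C] {M : Type*} [Monoid M]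
    [Finite M] {K : Type*} [Finite K] (T : SegmentType C M) (lab : C → K)
    (h : UpTree (Nat.card M + 1) C Set.univ) : T.Blurred lab := by
  by_contra hT
  obtain ⟨E, A, -, -, -, -, -, hc⟩ :=
    exists_segment_of_upTree (Nat.card M) T lab hT Set.ordConnected_univ h
  have hpos : 0 < (twoSidedMultiples (T.tp A E)).ncard :=
    (Set.ncard_pos (Set.toFinite _)).2 ⟨_, mem_twoSidedMultiples_self _⟩
  omega

end SegmentType

/-! ### Hausdorff rank and the absence of trees -/

section Hausdorff

variable {C : Type u} [LinearOrder C]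

/-- The segment `S` is obtained from finite ones by `k` iterated sums along well ordered or
inversely well ordered index sets. -/
def HausdorffLE : ℕ → Set C → Prop
  | 0, S => S.Finite
  | k + 1, S => ∃ (I : Type u) (_ : LinearOrder I) (f : C → I),
      (WellFoundedLT I ∨ WellFoundedGT I) ∧ MonotoneOn f S ∧ ∀ i, HausdorffLE k (S ∩ f ⁻¹' {i})

theorem HausdorffLE.mono {k : ℕ} {S S' : Set C} (hS : S' ⊆ S) (h : HausdorffLE k S) :
    HausdorffLE k S' := by
  induction k generalizing S S' with
  | zero => exact Set.Finite.subset h hS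
  | succ k ih =>
    obtain ⟨I, _, f, hI, hf, hk⟩ := h
    exact ⟨I, _, f, hI, hf.mono hS, fun i => ih (Set.inter_subset_inter_left _ hS) (hk i)⟩

theorem HausdorffLE.of_finite {k : ℕ} {S : Set C} (h : S.Finite) : HausdorffLE k S := by
  induction k generalizing S with
  | zero => exact h
  | succ k ih =>
    exact ⟨PUnit, inferInstance, fun _ => PUnit.unit, Or.inl inferInstance,
      fun _ _ _ _ _ => le_rfl, fun i => ih (h.subset Set.inter_subset_left)⟩

theorem HausdorffLE.of_dual {k : ℕ} {S : Set C}
    (h : HausdorffLE k (OrderDual.ofDual ⁻¹' S : Set Cᵒᵈ)) : HausdorffLE k S := by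
  induction k generalizing S with
  | zero => exact h
  | succ k ih =>
    obtain ⟨I, _, f, hI, hf, hk⟩ := h
    refine ⟨Iᵒᵈ, inferInstance, fun x => OrderDual.toDual (f (OrderDual.toDual x)), ?_,
      fun x hx y hy hxy => hf (show OrderDual.toDual y ∈ _ from hy) hx hxy,
      fun i => ih (hk (OrderDual.ofDual i))⟩
    rcases hI with hI | hI
    · exact Or.inr inferInstance
    · exact Or.inl inferInstance

/-- Letting `B` be any chain embedded in `S` makes the induction apply to fibres, which are types
and not subsets of `C`. -/
theorem HausdorffLE.exists_hasHdeg {k : ℕ} {S : Set C} (h : HausdorffLE k S) {B : Type u}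
    [LinearOrder B] (j : B ↪o C) (hj : ∀ b, j b ∈ S) :
    ∃ β : Ordinal.{u}, β ≤ k ∧ HasHdeg β B := by
  induction k generalizing S B with
  | zero =>
    refine ⟨0, by simp, ?_⟩
    rw [HasHdeg]
    refine Or.inl ⟨rfl, ?_⟩
    have : Finite S := h
    exact Finite.of_injective (fun b => (⟨j b, hj b⟩ : S)) fun a b hab =>
      j.injective (congrArg Subtype.val hab)
  | succ k ih =>
    by_cases hlt : ∃ β : Ordinal.{u}, β < (k + 1 : ℕ) ∧ HasHdeg β B
    · obtain ⟨β, hβ, hB⟩ := hlt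
      exact ⟨β, hβ.le, hB⟩
    · push Not at hlt
      refine ⟨(k + 1 : ℕ), le_rfl, ?_⟩
      obtain ⟨I, _, f, hI, hf, hk⟩ := h
      rw [HasHdeg]
      refine Or.inr ⟨by simp, fun β hβ => hlt β hβ, I, _, fun b => f (j b), hI,
        fun a b hab => hf (hj a) (hj b) (j.monotone hab), fun i => ?_⟩
      obtain ⟨β, hβ, hB⟩ := ih (hk i) (B := {b : B // f (j b) = i})
        ((OrderEmbedding.subtype _).trans j) fun b => ⟨hj b.1, b.2⟩
      exact ⟨β, hβ.trans_lt (by exact_mod_cast k.lt_succ_self), hB⟩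

/-- The segment `S` is an inversely well ordered sum of segments `HausdorffLE k`. -/
def IsDescendingSum (k : ℕ) (S : Set C) : Prop :=
  ∃ (I : Type u) (_ : LinearOrder I) (f : C → I),
    WellFoundedGT I ∧ MonotoneOn f S ∧ ∀ i, HausdorffLE k (S ∩ f ⁻¹' {i})

namespace IsDescendingSum

variable {k : ℕ}

theorem mono {S S' : Set C} (hS : S' ⊆ S) (h : IsDescendingSum k S) : IsDescendingSum k S' := by
  obtain ⟨I, _, f, hI, hf, hk⟩ := h
  exact ⟨I, _, f, hI, hf.mono hS, fun i => (hk i).mono (Set.inter_subset_inter_left _ hS)⟩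

theorem of_hausdorffLE {S : Set C} (h : HausdorffLE k S) : IsDescendingSum k S :=
  ⟨PUnit, inferInstance, fun _ => PUnit.unit, inferInstance, fun _ _ _ _ _ => le_rfl,
    fun _ => h.mono Set.inter_subset_left⟩

theorem wellFoundedGT_sigmaLex {W : Type*} [LinearOrder W] [WellFoundedGT W] {I : W → Type*}
    [∀ w, LinearOrder (I w)] [∀ w, WellFoundedGT (I w)] : WellFoundedGT (Σₗ w, I w) := by
  refine ⟨?_⟩
  rw [WellFounded.wellFounded_iff_has_min]
  intro s hs
  obtain ⟨w, ⟨⟨w', i₀⟩, hi₀, rfl⟩, hw⟩ :=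
    (wellFounded_gt (α := W)).has_min (Sigma.fst '' s) (hs.image _)
  obtain ⟨i, hi, hmax⟩ := (wellFounded_gt (α := I w')).has_min {i | (⟨w', i⟩ : Σ w, I w) ∈ s}
    ⟨i₀, hi₀⟩
  refine ⟨⟨w', i⟩, hi, ?_⟩
  rintro ⟨v, j⟩ hj hlt
  rcases Sigma.Lex.lt_def.1 hlt with h | ⟨h, h'⟩
  · exact hw v ⟨_, hj, rfl⟩ h
  · change w' = v at h
    subst h
    exact hmax j hj h'

/-- The lexicographic sum of the index orders is again inversely well ordered, so the rank `k` of
the summands does not rise. -/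
theorem sum {S : Set C} {W : Type u} [LinearOrder W] [WellFoundedGT W] (g : C → W)
    (hg : MonotoneOn g S) (h : ∀ w, IsDescendingSum k (S ∩ g ⁻¹' {w})) :
    IsDescendingSum k S := by
  choose I hI f hwf hf hk using h
  have := @wellFoundedGT_sigmaLex W _ _ I _ _
  refine ⟨Σₗ w, I w, inferInstance, fun x => toLex ⟨g x, f (g x) x⟩, this, ?_, ?_⟩
  · intro x hx y hy hxy
    rw [Sigma.Lex.le_def]
    rcases (hg hx hy hxy).lt_or_eq with hlt | heq
    · exact Or.inl hlt
    · refine Or.inr ⟨heq, ?_⟩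
      have key : ∀ w (hw : g x = w), g y = w → hw ▸ f (g x) x ≤ f w y := by
        rintro w rfl hy'
        exact hf (g x) ⟨hx, rfl⟩ ⟨hy, hy'⟩ hxy
      exact key (g y) heq rfl
  · rintro ⟨w, i⟩
    refine (hk w i).mono ?_
    rintro x ⟨hx, hxi⟩
    have hxi' : (⟨g x, f (g x) x⟩ : Σ w, I w) = ⟨w, i⟩ := hxi
    obtain ⟨rfl, hi⟩ := Sigma.mk.inj_iff.1 hxi'
    exact ⟨⟨hx, rfl⟩, eq_of_heq hi⟩

theorem union {S S' : Set C} (hlt : ∀ x ∈ S, ∀ y ∈ S', x < y) (h : IsDescendingSum k S)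
    (h' : IsDescendingSum k S') : IsDescendingSum k (S ∪ S') := by
  classical
  refine sum (W := ULift Bool) (fun x => ⟨decide (x ∉ S)⟩) ?_ ?_
  · intro x hx y hy hxy
    change decide (x ∉ S) ≤ decide (y ∉ S)
    by_cases hyS : y ∈ S
    · have hxS : x ∈ S := hx.resolve_right fun hx' => (hlt y hyS x hx').not_ge hxy
      simp [hxS]
    · simp [hyS]
  · rintro ⟨_ | _⟩
    · refine h.mono ?_
      rintro x ⟨-, hx⟩
      simpa using hx
    · refine h'.mono ?_
      rintro x ⟨hx, hx'⟩
      exact hx.resolve_left (by simpa using hx')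

/-- Every set contains an inversely well ordered coinitial subset. -/
theorem exists_wellFoundedGT_coinitial (S : Set C) :
    ∃ W ⊆ S, WellFoundedGT W ∧ ∀ x ∈ S, ∃ w ∈ W, w ≤ x := by
  let r : C → C → Prop := WellOrderingRel
  -- These are the points below all their predecessors in `S` under a well-ordering; on them that
  -- well-ordering is the reverse of the given order.
  let W : Set C := {w | w ∈ S ∧ ∀ v ∈ S, r v w → w < v}
  refine ⟨W, fun w hw => hw.1, ⟨?_⟩, fun x hx => ?_⟩
  · refine Subrelation.wf ?_ (InvImage.wf (fun w : W => (w : C)) (IsWellFounded.wf (r := r)))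
    intro a b hab
    rcases trichotomous_of r (a : C) (b : C) with h | h | h
    · exact h
    · exact absurd (Subtype.ext h) (ne_of_gt hab)
    · exact absurd (a.2.2 b b.2.1 h) (not_lt_of_gt hab)
  · obtain ⟨w, ⟨hw, hwx⟩, hmin⟩ := (IsWellFounded.wf (r := r)).has_min {w | w ∈ S ∧ w ≤ x}
      ⟨x, hx, le_rfl⟩
    refine ⟨w, ⟨hw, fun v hv hvw => ?_⟩, hwx⟩
    by_contra hle
    exact hmin v ⟨hv, (not_lt.1 hle).trans hwx⟩ hvw

/-- Each point is sent to the greatest element below or equal to it of an inversely well ordered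
coinitial set; the fibre over `w` lies in `S ∩ Set.Ici w`. -/
theorem of_forall_Ici {S : Set C} (h : ∀ x ∈ S, IsDescendingSum k (S ∩ Set.Ici x)) :
    IsDescendingSum k S := by
  obtain ⟨W, hWS, hwf, hco⟩ := exists_wellFoundedGT_coinitial S
  rcases W.eq_empty_or_nonempty with rfl | ⟨w₀, hw₀⟩
  · have : S ⊆ ∅ := fun x hx => by
      obtain ⟨w, hw, -⟩ := hco x hx
      exact hw
    exact of_hausdorffLE (.of_finite (Set.finite_empty.subset this))
  have hmax (x : C) : ∃ w : W, x ∈ S → (w : C) ≤ x ∧ ∀ v : W, (v : C) ≤ x → v ≤ w := by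
    by_cases hx : x ∈ S
    · obtain ⟨w, hw, hwx⟩ := hco x hx
      obtain ⟨v, hv, hm⟩ := (wellFounded_gt (α := W)).has_min {v : W | (v : C) ≤ x} ⟨⟨w, hw⟩, hwx⟩
      exact ⟨v, fun _ => ⟨hv, fun u hu => not_lt.1 (hm u hu)⟩⟩
    · exact ⟨⟨w₀, hw₀⟩, fun h => absurd h hx⟩
  choose g hg using hmax
  refine sum g (fun x hx y hy hxy => (hg y hy).2 _ ((hg x hx).1.trans hxy)) fun w => ?_
  refine (h w (hWS w.2)).mono ?_
  rintro x ⟨hx, rfl⟩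
  exact ⟨hx, (hg x hx).1⟩

end IsDescendingSum

theorem UpTree.mono {k : ℕ} {S S' : Set C} (hS : S ⊆ S') (h : UpTree k C S) :
    UpTree k C S' := by
  cases k with
  | zero => exact Set.Nonempty.mono hS h
  | succ k =>
    obtain ⟨D, hD, hlt, ht⟩ := h
    exact ⟨D, fun i => ⟨(hD i).1.trans hS, (hD i).2⟩, hlt, ht⟩

theorem UpTree.nonempty {k : ℕ} {C : Type u} [LinearOrder C] {S : Set C} (h : UpTree k C S) :
    S.Nonempty := by
  induction k generalizing C with
  | zero => exact h
  | succ k ih =>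
    obtain ⟨D, hD, -, ht⟩ := h
    obtain ⟨x, hx⟩ := ih (ht 0)
    exact ⟨OrderDual.ofDual x, (hD 0).1 hx⟩

/-- At positive height, dropping the first branch leaves a tree above any point of that branch. -/
theorem UpTree.exists_Ici {k : ℕ} {S : Set C} (h : UpTree k C S) :
    ∃ z ∈ S, UpTree k C (S ∩ Set.Ici z) := by
  cases k with
  | zero =>
    obtain ⟨z, hz⟩ := h
    exact ⟨z, hz, z, hz, le_rfl⟩
  | succ k =>
    obtain ⟨D, hD, hlt, ht⟩ := h
    obtain ⟨z, hz⟩ := (ht 0).nonempty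
    refine ⟨OrderDual.ofDual z, (hD 0).1 hz, fun i => D (i + 1), fun i => ⟨fun x hx =>
      ⟨(hD _).1 hx, (hlt 0 (i + 1) i.succ_pos _ hz x hx).le⟩, (hD _).2⟩,
      fun i j hij => hlt _ _ (by omega), fun i => ht _⟩

/-- If the proper initial parts of `L` are descending sums and `L` has no trees of height `k + 1`,
then `L` is a descending sum, given that segments without dual trees of height `k` are. -/
theorem IsDescendingSum.of_forall_Iic {k : ℕ} {L : Set C} (hL : L.OrdConnected)
    (hno : ¬ UpTree (k + 1) C L)
    (ih : ∀ S : Set C, S.OrdConnected → ¬ UpTree k Cᵒᵈ (OrderDual.ofDual ⁻¹' S) →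
      HausdorffLE k S)
    (h : ∀ x ∈ L, IsDescendingSum k (L ∩ Set.Iic x)) : IsDescendingSum k L := by
  rcases L.eq_empty_or_nonempty with rfl | ⟨x₀, hx₀⟩
  · exact IsDescendingSum.of_forall_Ici fun x hx => hx.elim
  obtain ⟨z, hz, hzno⟩ : ∃ z ∈ L, ∀ z' ∈ L,
      ¬ UpTree k Cᵒᵈ (OrderDual.ofDual ⁻¹' (L ∩ Set.Ioc z z')) := by
    by_contra hcon
    push Not at hcon
    -- Otherwise dual trees occur beyond every point, and iteration strings them into a tree of
    -- height `k + 1`.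
    choose! next hnext htree using hcon
    have hlt {z : C} (hz : z ∈ L) : z < next z := by
      obtain ⟨x, -, hx⟩ := (htree z hz).nonempty
      exact lt_of_lt_of_le hx.1 hx.2
    let s : ℕ → C := fun n => next^[n] x₀
    have hs (n : ℕ) : s (n + 1) = next (s n) := Function.iterate_succ_apply' next n x₀
    have hsL (n : ℕ) : s n ∈ L := by
      induction n with
      | zero => exact hx₀
      | succ n ih => rw [hs]; exact hnext _ ih
    have hmono : StrictMono s := strictMono_nat_of_lt_succ fun n => by
      rw [hs]; exact hlt (hsL n)
    refine hno ⟨fun n => L ∩ Set.Ioc (s n) (s (n + 1)),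
      fun n => ⟨Set.inter_subset_left, hL.inter Set.ordConnected_Ioc⟩, ?_, fun n => ?_⟩
    · rintro i j hij x ⟨-, -, hx⟩ y ⟨-, hy, -⟩
      exact (hx.trans (hmono.monotone (Nat.succ_le_of_lt hij))).trans_lt hy
    · have := htree _ (hsL n)
      rwa [← hs] at this
  -- A dual tree beyond `z` could be cut down to one bounded above, which the choice of `z`
  -- excludes.
  have hright : HausdorffLE k (L ∩ Set.Ioi z) := by
    refine ih _ (hL.inter Set.ordConnected_Ioi) fun ht => ?_
    obtain ⟨z', hz', ht'⟩ := ht.exists_Ici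
    exact hzno (OrderDual.ofDual z') hz'.1
      (ht'.mono fun x hx => ⟨hx.1.1, hx.1.2, hx.2⟩)
  refine ((h z hz).union (fun x hx y hy => lt_of_le_of_lt hx.2 hy.2)
    (IsDescendingSum.of_hausdorffLE hright)).mono fun x hx => ?_
  rcases le_or_gt x z with hxz | hxz
  · exact Or.inl ⟨hx, hxz⟩
  · exact Or.inr ⟨hx, hxz⟩

/-- A subset of a scattered chain with more than one element is not densely ordered: it has two
elements with none in between. -/
theorem exists_adjacent_of_scattered (hC : IsScatteredChain C) (Q : Set C) {x y : C}
    (hx : x ∈ Q) (hy : y ∈ Q) (hxy : x < y) :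
    ∃ a ∈ Q, ∃ b ∈ Q, a < b ∧ ∀ z ∈ Q, a < z → ¬ z < b := by
  by_contra hcon
  push Not at hcon
  have hd : DenselyOrdered Q := by
    refine ⟨fun a b hab => ?_⟩
    obtain ⟨z, hz, h1, h2⟩ := hcon a a.2 b b.2 hab
    exact ⟨⟨z, hz⟩, h1, h2⟩
  have hn : Nontrivial Q := ⟨⟨x, hx⟩, ⟨y, hy⟩, fun h => hxy.ne (congrArg Subtype.val h)⟩
  obtain ⟨e⟩ := Order.embedding_from_countable_to_dense ℚ Q
  exact hC.elim (e.trans (OrderEmbedding.subtype _))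

theorem IsDescendingSum.uIcc_trans {k : ℕ} {x y z : C} (h : IsDescendingSum k (Set.uIcc x y))
    (h' : IsDescendingSum k (Set.uIcc y z)) : IsDescendingSum k (Set.uIcc x z) := by
  have main {x z : C} (hxz : x ≤ z) (h : IsDescendingSum k (Set.uIcc x y))
      (h' : IsDescendingSum k (Set.uIcc y z)) : IsDescendingSum k (Set.uIcc x z) := by
    have hd : ∀ v ∈ Set.uIcc x y ∩ Set.Iic y, ∀ w ∈ Set.uIcc y z ∩ Set.Ioi y, v < w :=
      fun v hv w hw => lt_of_le_of_lt hv.2 hw.2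
    refine ((h.mono Set.inter_subset_left).union hd (h'.mono Set.inter_subset_left)).mono ?_
    rw [Set.uIcc_of_le hxz]
    rintro w ⟨hxw, hwz⟩
    rcases le_or_gt w y with hw | hw
    · exact Or.inl ⟨Set.Icc_subset_uIcc ⟨hxw, hw⟩, hw⟩
    · exact Or.inr ⟨Set.Icc_subset_uIcc ⟨hw.le, hwz⟩, hw⟩
  rcases le_total x z with hxz | hxz
  · exact main hxz h h'
  · rw [Set.uIcc_comm] at h h' ⊢
    exact main hxz h' h

/-- For the classes of the relation `r`, an interval whose points are each related to one of its
ends splits into an initial part for `of_forall_Iic` and a final part for `of_forall_Ici`. So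
classes with adjacent representatives coincide, and by scatteredness there is at most one class. -/
theorem IsDescendingSum.of_not_upTree (hC : IsScatteredChain C) {k : ℕ} {S : Set C}
    (hS : S.OrdConnected) (hno : ¬ UpTree (k + 1) C S)
    (ih : ∀ S : Set C, S.OrdConnected → ¬ UpTree k Cᵒᵈ (OrderDual.ofDual ⁻¹' S) →
      HausdorffLE k S) : IsDescendingSum k S := by
  let r : Setoid S :=
    { r := fun x y => IsDescendingSum k (Set.uIcc (x : C) y)
      iseqv := ⟨fun x => by
          rw [Set.uIcc_self]
          exact of_hausdorffLE (.of_finite (Set.finite_singleton _)),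
        fun {x y} h => by rwa [Set.uIcc_comm], fun h h' => h.uIcc_trans h'⟩ }
  let rep (x : S) : S := (Quotient.mk r x).out
  have hrep (x : S) : IsDescendingSum k (Set.uIcc (rep x : C) x) :=
    Quotient.exact (s := r) (Quotient.out_eq (Quotient.mk r x))
  have hrep_eq {x y : S} (h : IsDescendingSum k (Set.uIcc (x : C) y)) : rep x = rep y :=
    congrArg Quotient.out (Quotient.sound (s := r) h)
  have hrep_rep (x : S) : rep (rep x) = rep x := hrep_eq (hrep x)
  have hadj {a b : S} (hab : a < b)
      (h : ∀ z : S, a ≤ z → z ≤ b → IsDescendingSum k (Set.uIcc (a : C) z) ∨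
        IsDescendingSum k (Set.uIcc (z : C) b)) : IsDescendingSum k (Set.Icc (a : C) b) := by
    have hsub : Set.Icc (a : C) b ⊆ S := hS.out a.2 b.2
    let L : Set C := {z | z ∈ Set.Icc (a : C) b ∧ IsDescendingSum k (Set.Icc (a : C) z)}
    have hL : IsDescendingSum k L := by
      refine of_forall_Iic ⟨?_⟩ (fun ht => hno (ht.mono fun z hz => hsub hz.1)) ih fun z hz =>
        hz.2.mono fun w hw => Set.mem_Icc.2 ⟨hw.1.1.1, hw.2⟩
      rintro z hz w hw v ⟨hzv, hvw⟩
      exact ⟨⟨hz.1.1.trans hzv, hvw.trans hw.1.2⟩, hw.2.mono (Set.Icc_subset_Icc_right hvw)⟩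
    have hR : IsDescendingSum k (Set.Icc (a : C) b \ L) := by
      refine of_forall_Ici fun z hz => ?_
      have hzb := (h ⟨z, hsub hz.1⟩ hz.1.1 hz.1.2).resolve_left fun hz' => hz.2 ⟨hz.1, by
        rwa [Set.uIcc_of_le hz.1.1] at hz'⟩
      rw [Set.uIcc_of_le hz.1.2] at hzb
      exact hzb.mono fun w hw => Set.mem_Icc.2 ⟨hw.2, hw.1.1.2⟩
    refine (hL.union (fun z hz w hw => ?_) hR).mono fun z hz => ?_
    · by_contra hle
      exact hw.2 ⟨hw.1, hz.2.mono (Set.Icc_subset_Icc_right (not_lt.1 hle))⟩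
    · by_cases hzL : z ∈ L
      · exact Or.inl hzL
      · exact Or.inr ⟨hz, hzL⟩
  have hone (x y : S) : rep x = rep y := by
    by_contra hne
    have hlt : ∃ x y : S, rep x < rep y := by
      rcases lt_or_gt_of_ne hne with h | h
      · exact ⟨x, y, h⟩
      · exact ⟨y, x, h⟩
    obtain ⟨x, y, hxy⟩ := hlt
    obtain ⟨_, ⟨a, rfl⟩, _, ⟨b, rfl⟩, hab, hmid⟩ := exists_adjacent_of_scattered hC
      (Set.range fun z => (rep z : C)) ⟨x, rfl⟩ ⟨y, rfl⟩ hxy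
    refine hab.ne (congrArg Subtype.val ?_)
    have hG : IsDescendingSum k (Set.Icc (rep a : C) (rep b)) := by
      refine hadj hab fun z haz hzb => ?_
      -- No representative lies strictly between the two, so the interval from `rep z` to `z` covers
      -- the one from `z` to `rep a` or to `rep b`.
      rcases le_or_gt (rep z) (rep a) with hle | hgt
      · refine Or.inl ((hrep z).mono ?_)
        rw [Set.uIcc_of_le (show (rep a : C) ≤ z from haz)]
        exact (Set.Icc_subset_Icc_left (show (rep z : C) ≤ rep a from hle)).trans
          Set.Icc_subset_uIcc
      · have hge : (rep b : C) ≤ rep z := not_lt.1 (hmid _ ⟨z, rfl⟩ hgt)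
        refine Or.inr ((hrep z).mono ?_)
        rw [Set.uIcc_of_le (show (z : C) ≤ rep b from hzb)]
        exact (Set.Icc_subset_Icc_right hge).trans Set.Icc_subset_uIcc'
    rw [← Set.uIcc_of_le hab.le] at hG
    rw [← hrep_rep a, ← hrep_rep b]
    exact hrep_eq hG
  refine of_forall_Iic hS hno ih fun x hx => of_forall_Ici fun y hy => ?_
  have hxy : IsDescendingSum k (Set.uIcc y x) :=
    Quotient.exact (s := r) (a := ⟨y, hy.1⟩) (b := ⟨x, hx⟩)
      (Quotient.out_injective (hone ⟨y, hy.1⟩ ⟨x, hx⟩))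
  rw [Set.uIcc_of_le hy.2] at hxy
  exact hxy.mono fun z hz => Set.mem_Icc.2 ⟨hz.2, hz.1.2⟩

theorem IsScatteredChain.dual (hC : IsScatteredChain C) : IsScatteredChain Cᵒᵈ := by
  refine ⟨fun e => hC.elim ?_⟩
  refine OrderEmbedding.ofStrictMono (fun q => OrderDual.ofDual (e (-q))) fun a b hab => ?_
  exact e.strictMono (neg_lt_neg hab)

end Hausdorff

theorem hausdorffLE_of_not_upTree (k : ℕ) {C : Type u} [LinearOrder C] (hC : IsScatteredChain C)
    {S : Set C} (hS : S.OrdConnected) (h : ¬ UpTree k C S) : HausdorffLE k S := by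
  induction k generalizing C with
  | zero =>
    rw [show S = ∅ from Set.not_nonempty_iff_eq_empty.1 h]
    exact Set.finite_empty
  | succ k ih =>
    obtain ⟨I, _, f, hI, hf, hk⟩ := IsDescendingSum.of_not_upTree hC hS h fun S hS h =>
      (ih hC.dual hS.dual h).of_dual
    exact ⟨I, _, f, Or.inr hI, hf, hk⟩

/-! ### Undefinability of choice -/

/-- The segment types of the expansions of `C` by parameters `P` and a further subset. -/
def parameterTypes {C : Type u} [LinearOrder C] (m : ℕ) {k : ℕ} (P : Fin k → Set C) :
    SegmentType C (MSOType m (((Fin k → Prop) × Prop) × Prop)) where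
  tp A D := msoType m (fun x => (((fun i => x ∈ P i), x ∈ A), False)) D
  congr h := msoType_congr m fun x hx => by rw [h x hx]
  union h := msoType_union m _ h
  iUnion_increasing h h' he := msoType_iUnion m h h' he
  iUnion_decreasing h h' he := msoType_iUnion (I := ℕᵒᵈ) m (fun i j hij x hx y hy =>
    h j i hij y hy x hx) (fun i j hij x hx y hy => h' j i hij y hy x hx) he

/-- A formula of depth at most `m` does not distinguish two elements of `A` with the same
membership in the parameters that cut off segments of the same types. -/
theorem holds_iff_of_tp_eq {C : Type u} [LinearOrder C] {m k : ℕ}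
    {φ : MonadicFormula 1 (k + 1)} (hφ : φ.depth ≤ m) {P : Fin k → Set C} {A : Set C} {a b : C}
    (ha : a ∈ A) (hb : b ∈ A) (hP : (fun i => a ∈ P i) = fun i => b ∈ P i)
    (h1 : (parameterTypes m P).tp A (Set.Iio a) = (parameterTypes m P).tp A (Set.Iio b))
    (h2 : (parameterTypes m P).tp A (Set.Ioi a) = (parameterTypes m P).tp A (Set.Ioi b)) :
    φ.Holds a A P ↔ φ.Holds b A P := by
  -- The last component marks the chosen element; the constant `False` in `parameterTypes` is its
  -- value on both sides of that element.
  let c (a x : C) : ((Fin k → Prop) × Prop) × Prop := (((fun i => x ∈ P i), x ∈ A), x = a)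
  have hsplit (a : C) : msoType m (c a) Set.univ = (parameterTypes m P).tp A (Set.Iio a) *
      msoType m (c a) {a} * (parameterTypes m P).tp A (Set.Ioi a) := by
    have huniv : (Set.univ : Set C) = Set.Iio a ∪ {a} ∪ Set.Ioi a := by
      ext x
      simp
    rw [huniv, msoType_union, msoType_union]
    · congr 1
      · congr 1
        exact msoType_congr m fun x hx => Prod.ext rfl (eq_false (ne_of_lt hx))
      · exact msoType_congr m fun x hx => Prod.ext rfl (eq_false (ne_of_gt hx))
    · rintro x hx y rfl
      exact hx
    · rintro x (hx | rfl) y hy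
      · exact lt_trans hx hy
      · exact hy
  have hc : c a a = c b b := by
    refine Prod.ext (Prod.ext hP ?_) ?_
    · exact propext ⟨fun _ => hb, fun _ => ha⟩
    · exact propext ⟨fun _ => rfl, fun _ => rfl⟩
  have heq : msoType m (c a) Set.univ = msoType m (c b) Set.univ := by
    rw [hsplit, hsplit, h1, h2, msoType_singleton m hc]
  refine φ.sat_iff_of_msoType_eq hφ heq (Fin.cons (fun s => s.1.2) fun i s => s.1.1 i)
    (fun _ s => s.2) ?_ ?_ (fun _ _ => Iff.rfl) (fun _ _ => Iff.rfl)
  all_goals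
    intro X z
    refine Fin.cases ?_ (fun X => ?_) X
    · exact Iff.rfl
    · exact Iff.rfl

theorem mainTheorem8 (m l : ℕ) :
    ∃ n : ℕ, ∀ (C : Type u) [LinearOrder C],
      IsScatteredChain C → HdegGE C ((n + 1 : ℕ) : Ordinal.{u}) →
        ¬ ∃ k : ℕ, k ≤ l ∧ ∃ (φ : MonadicFormula 1 (k + 1)) (P : Fin k → Set C),
          φ.depth ≤ m ∧ φ.DefinesChoice P := by
  -- The monoid depends on the number `k` of parameters; summing over `k ≤ l` bounds all cases at
  -- once.
  let N (k : ℕ) : ℕ := Nat.card (MSOType m (((Fin k → Prop) × Prop) × Prop)) + 1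
  refine ⟨∑ k ∈ Finset.range (l + 1), N k, fun C _ hC hdeg => ?_⟩
  rintro ⟨k, hk, φ, P, hφ, hin, hex, huniq⟩
  have hN : N k ≤ ∑ k ∈ Finset.range (l + 1), N k :=
    Finset.single_le_sum (fun _ _ => Nat.zero_le _) (Finset.mem_range.2 (Nat.lt_succ_of_le hk))
  have htree : UpTree (N k) C Set.univ := by
    by_contra hno
    obtain ⟨β, hβ, hB⟩ := (hausdorffLE_of_not_upTree (N k) hC Set.ordConnected_univ
      hno).exists_hasHdeg (RelEmbedding.refl _) fun b => Set.mem_univ _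
    refine hdeg β (hβ.trans_lt ?_) hB
    exact_mod_cast Nat.lt_succ_of_le hN
  obtain ⟨A, hA, hblur⟩ := (parameterTypes m P).blurred_of_upTree
    (fun x => (fun i => x ∈ P i : Fin k → Prop)) htree
  obtain ⟨a, ha⟩ := hex A hA
  have haA := (hin a A ha).2
  obtain ⟨b, hb, hne, hl, h1, h2⟩ := hblur a haA
  exact hne (huniq a b A ha ((holds_iff_of_tp_eq hφ haA hb hl h1 h2).1 ha))
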